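/- Let $n\ge 2$, let $N$ be a compact smooth $(n-1)$-dimensional manifold, with or without boundary, let $-\infty\le a<b\le+\infty$ and let $M=(a,b)\times N$. Let $g=dr^2+G(r)$ be a smooth Riemannian metric on $M$, where $G(r)$, $r\in(a,b)$, is a family of Riemannian metrics on $N$, and let $g_0=dr^2+\mathring h(r)^2\hat G$ be a background warped product metric, where $\mathring h$ is a smooth positive function on $(a,b)$ and $\hat G$ is a fixed smooth Riemannian metric on $N$, with Riemannian measure $\mu_{\hat G}$. Let $H$ and $\mathring H$ be the mean curvatures (traces of the Weingarten map $X\mapsto\nabla_X\partial_r$) of the level sets $N(r)=\{r\}\times N$ relative to $g$ and $g_0$ respectively, and let $R_{rr}$ and $\mathring R_{rr}$ be the Ricci curvatures of $g$ and $g_0$ in the direction $(\partial_r,\partial_r)$. Define $$m(r,x)=\mathring h(r)^2\bigl(\mathring H(r,x)-H(r,x)\bigr),\qquad \mathcal M(r)=\int_N m(r,x)\,d\mu_{\hat G}(x).$$ Assume that the finite limits $\mathcal M(a)=\lim_{r\to a}\mathcal M(r)$ and $\mathcal M(b)=\lim_{r\to b}\mathcal M(r)$ exist and that $\mathring h^2(R_{rr}-\mathring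 R_{rr})\in L^1(M,dr\,d\mu_{\hat G})$. Then $$\mathcal M(b)-\mathcal M(a)\ \ge\ \int_M \mathring h^2(R_{rr}-\mathring R_{rr})\,dr\,d\mu_{\hat G},$$ and equality holds if and only if there is a fixed smooth Riemannian metric $\widetilde G$ on $N$ such that $G(r)=\mathring h(r)^2\widetilde G$ for all $r\in(a,b)$. If moreover $g$ is asymptotic to $g_0$ at some $r_0\in[a,b]$, meaning that the norm of the tensor $G(r)-\mathring h(r)^2\hat G$ with respect to $\mathring h(r)^2\hat G$ tends to $0$ uniformly on $N$ as $r\in(a,b)$ tends to $r_0$ (for $r_0\in(a,b)$: the two metrics coincide on $N(r_0)$), then equality holds if and only if $g=g_0$ on $M$. -/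

import Mathlib

open Set Filter Topology MeasureTheory
open scoped Manifold ContDiff ENNReal

noncomputable section

namespace RadialMass

section Charts

variable {V : Type*} [NormedAddCommGroup V] [NormedSpace ℝ V]
  {H : Type*} [TopologicalSpace H] (I : ModelWithCorners ℝ V H)
  {M : Type*} [TopologicalSpace M] [ChartedSpace H M]
  {ι : Type*} [Fintype ι] [DecidableEq ι] (b : Module.Basis ι ℝ V)

/-- The coordinate vector field `∂ᵢ` of the preferred chart around `p`, at the point of coordinates
`z`: the image of the `i`-th basis vector under the differential of the inverse chart. -/
def coordVec (p : M) (z : V) (i : ι) : TangentSpace I ((extChartAt I p).symm z) :=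
  mfderivWithin 𝓘(ℝ, V) I (extChartAt I p).symm (range I) z (b i)

/-- The matrix `g_{ij}` of a bilinear form on the tangent spaces, in the preferred chart around
`p`, at the point of coordinates `z`. -/
def coordMatrix (g : ∀ q : M, TangentSpace I q →L[ℝ] TangentSpace I q →L[ℝ] ℝ)
    (p : M) (z : V) : Matrix ι ι ℝ :=
  Matrix.of fun i j =>
    g ((extChartAt I p).symm z) (coordVec I b p z i) (coordVec I b p z j)

/-- The partial derivative `∂ᵢ f` in a chart. Derivatives are taken within the range of the model,
so that boundary points are allowed. -/
def coordDeriv (i : ι) (f : V → ℝ) (z : V) : ℝ :=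
  fderivWithin ℝ f (range I) z (b i)

/-- The Christoffel symbol `Γᵏᵢⱼ` of the metric `g` in the preferred chart around `p`, at the point
of coordinates `z`. -/
def christoffel (g : ∀ q : M, TangentSpace I q →L[ℝ] TangentSpace I q →L[ℝ] ℝ)
    (p : M) (k i j : ι) (z : V) : ℝ :=
  (1 / 2) * ∑ l, (coordMatrix I b g p z)⁻¹ k l *
    (coordDeriv I b i (fun y => coordMatrix I b g p y j l) z
      + coordDeriv I b j (fun y => coordMatrix I b g p y i l) z
      - coordDeriv I b l (fun y => coordMatrix I b g p y i j) z)

/-- The component `R_{ij}` at `p` of the Ricci tensor of the metric `g`, in the preferred chart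
around `p`. With this sign the round spheres have positive Ricci curvature. -/
def ricci (g : ∀ q : M, TangentSpace I q →L[ℝ] TangentSpace I q →L[ℝ] ℝ)
    (p : M) (i j : ι) : ℝ :=
  (∑ k, (coordDeriv I b k (christoffel I b g p k i j) (extChartAt I p p)
      - coordDeriv I b j (christoffel I b g p k i k) (extChartAt I p p)))
  + ∑ k, ∑ l,
      (christoffel I b g p k k l (extChartAt I p p) * christoffel I b g p l i j (extChartAt I p p)
      - christoffel I b g p k j l (extChartAt I p p) * christoffel I b g p l i k (extChartAt I p p))

end Charts

section Volume

variable {d : ℕ} {H : Type*} [TopologicalSpace H]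
  (I : ModelWithCorners ℝ (EuclideanSpace ℝ (Fin d)) H)
  {N : Type*} [TopologicalSpace N] [ChartedSpace H N] [MeasurableSpace N]

/-- The standard basis of `ℝ^d`. -/
def stdBasis (d : ℕ) : Module.Basis (Fin d) ℝ (EuclideanSpace ℝ (Fin d)) :=
  (EuclideanSpace.basisFun (Fin d) ℝ).toBasis

/-- The measure `√(det g_{AB}) dx¹ ⋯ dx^d` on the domain of the preferred chart around `p`. -/
def chartVolume (g : ∀ x : N, TangentSpace I x →L[ℝ] TangentSpace I x →L[ℝ] ℝ)
    (p : N) : Measure N :=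
  ((volume.restrict (extChartAt I p).target).withDensity
    fun z => ENNReal.ofReal (Real.sqrt (coordMatrix I (stdBasis d) g p z).det)).map
      (extChartAt I p).symm

/-- The Riemannian measure `μ_g`: the smallest measure which dominates `√(det g_{AB}) dx` on every
chart. As the chart measures agree on overlaps, its restriction to the domain of each chart is
`√(det g_{AB}) dx`. -/
def riemannianMeasure (g : ∀ x : N, TangentSpace I x →L[ℝ] TangentSpace I x →L[ℝ] ℝ) :
    Measure N :=
  ⨆ p : N, chartVolume I g p

end Volume

section Radial

variable {d : ℕ} {H : Type*} [TopologicalSpace H]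
  (I : ModelWithCorners ℝ (EuclideanSpace ℝ (Fin d)) H)
  {N : Type*} [TopologicalSpace N] [ChartedSpace H N]

/-- The bilinear form `dr² + γ` on `ℝ × E`. -/
def radialForm {E : Type*} [NormedAddCommGroup E] [NormedSpace ℝ E] (γ : E →L[ℝ] E →L[ℝ] ℝ) :
    (ℝ × E) →L[ℝ] (ℝ × E) →L[ℝ] ℝ :=
  (ContinuousLinearMap.mul ℝ ℝ).bilinearComp
      (ContinuousLinearMap.fst ℝ ℝ E) (ContinuousLinearMap.fst ℝ ℝ E)
    + γ.bilinearComp (ContinuousLinearMap.snd ℝ ℝ E) (ContinuousLinearMap.snd ℝ ℝ E)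

/-- The metric `dr² + G(r)` on `ℝ × N`. -/
def radialMetric (G : ℝ → ∀ x : N, TangentSpace I x →L[ℝ] TangentSpace I x →L[ℝ] ℝ)
    (p : ℝ × N) : TangentSpace (𝓘(ℝ, ℝ).prod I) p →L[ℝ] TangentSpace (𝓘(ℝ, ℝ).prod I) p →L[ℝ] ℝ :=
  radialForm (E := EuclideanSpace ℝ (Fin d)) (G p.1 p.2)

/-- The warped product metric `dr² + h(r)² Ĝ` on `ℝ × N`. -/
def warpedMetric (h : ℝ → ℝ)
    (Ghat : ∀ x : N, TangentSpace I x →L[ℝ] TangentSpace I x →L[ℝ] ℝ) (p : ℝ × N) :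
    TangentSpace (𝓘(ℝ, ℝ).prod I) p →L[ℝ] TangentSpace (𝓘(ℝ, ℝ).prod I) p →L[ℝ] ℝ :=
  radialMetric I (fun r x => h r ^ 2 • Ghat x) p

theorem radialMetric_apply
    (G : ℝ → ∀ x : N, TangentSpace I x →L[ℝ] TangentSpace I x →L[ℝ] ℝ) (p : ℝ × N)
    (s t : ℝ) (v w : TangentSpace I p.2) :
    radialMetric I G p ((s, v) : ℝ × EuclideanSpace ℝ (Fin d))
      ((t, w) : ℝ × EuclideanSpace ℝ (Fin d)) = s * t + G p.1 p.2 v w :=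
  rfl

/-- The basis of `ℝ × ℝ^d` giving the coordinates `(r, x¹, …, x^d)`; the index of `r` is
`Sum.inl ()` and that of `x^A` is `Sum.inr A`. -/
def radialBasis (d : ℕ) : Module.Basis (Unit ⊕ Fin d) ℝ (ℝ × EuclideanSpace ℝ (Fin d)) :=
  (Module.Basis.singleton Unit ℝ).prod (stdBasis d)

/-- The Ricci curvature `R_{rr}` of the metric `g` on `ℝ × N` in the direction `(∂_r, ∂_r)`. -/
def ricciRR (g : ∀ p : ℝ × N, TangentSpace (𝓘(ℝ, ℝ).prod I) p →L[ℝ]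
    TangentSpace (𝓘(ℝ, ℝ).prod I) p →L[ℝ] ℝ) (p : ℝ × N) : ℝ :=
  ricci (𝓘(ℝ, ℝ).prod I) (radialBasis d) g p (Sum.inl ()) (Sum.inl ())

/-- The Weingarten map `X ↦ ∇_X ∂_r` at `p` of the level set of `r` through `p`, with respect to the
unit normal `∂_r` of a metric `g = dr² + G(r)`: its matrix is `S^B_A = Γ^B_{A r}`. -/
def weingarten (g : ∀ p : ℝ × N, TangentSpace (𝓘(ℝ, ℝ).prod I) p →L[ℝ]
    TangentSpace (𝓘(ℝ, ℝ).prod I) p →L[ℝ] ℝ) (p : ℝ × N) : Matrix (Fin d) (Fin d) ℝ :=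
  Matrix.of fun B A => christoffel (𝓘(ℝ, ℝ).prod I) (radialBasis d) g p
    (Sum.inr B) (Sum.inr A) (Sum.inl ()) (extChartAt (𝓘(ℝ, ℝ).prod I) p p)

/-- The mean curvature at `p` of the level set of `r` through `p`, for a metric
`g = dr² + G(r)`. -/
def meanCurvature (g : ∀ p : ℝ × N, TangentSpace (𝓘(ℝ, ℝ).prod I) p →L[ℝ]
    TangentSpace (𝓘(ℝ, ℝ).prod I) p →L[ℝ] ℝ) (p : ℝ × N) : ℝ :=
  (weingarten I g p).trace

/-- The radial mass `m(r, x) = h(r)² (H₀ - H)` of `g`, relative to `g₀ = dr² + h(r)² Ĝ`. -/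
def radialMass (g : ∀ p : ℝ × N, TangentSpace (𝓘(ℝ, ℝ).prod I) p →L[ℝ]
    TangentSpace (𝓘(ℝ, ℝ).prod I) p →L[ℝ] ℝ) (h : ℝ → ℝ)
    (Ghat : ∀ x : N, TangentSpace I x →L[ℝ] TangentSpace I x →L[ℝ] ℝ) (p : ℝ × N) : ℝ :=
  h p.1 ^ 2 * (meanCurvature I (warpedMetric I h Ghat) p - meanCurvature I g p)

/-- The radial mass `ℳ(r) = ∫_N m(r, x) dμ_Ĝ(x)` of `g`, relative to `g₀ = dr² + h(r)² Ĝ`, on the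
level set of `r`. -/
def totalMass [MeasurableSpace N]
    (g : ∀ p : ℝ × N, TangentSpace (𝓘(ℝ, ℝ).prod I) p →L[ℝ]
    TangentSpace (𝓘(ℝ, ℝ).prod I) p →L[ℝ] ℝ) (h : ℝ → ℝ)
    (Ghat : ∀ x : N, TangentSpace I x →L[ℝ] TangentSpace I x →L[ℝ] ℝ) (r : ℝ) : ℝ :=
  ∫ x, radialMass I g h Ghat (r, x) ∂(riemannianMeasure I Ghat)

/-- The function `h² (R_{rr} - R⁰_{rr})` on `ℝ × N`, where `R_{rr}` and `R⁰_{rr}` are the radial Ricci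
curvatures of `g` and of `g₀ = dr² + h(r)² Ĝ`. -/
def ricciDefect (g : ∀ p : ℝ × N, TangentSpace (𝓘(ℝ, ℝ).prod I) p →L[ℝ]
    TangentSpace (𝓘(ℝ, ℝ).prod I) p →L[ℝ] ℝ) (h : ℝ → ℝ)
    (Ghat : ∀ x : N, TangentSpace I x →L[ℝ] TangentSpace I x →L[ℝ] ℝ) (p : ℝ × N) : ℝ :=
  h p.1 ^ 2 * (ricciRR I g p - ricciRR I (warpedMetric I h Ghat) p)

/-- The open interval `(a, b)` of the real line, where `a` and `b` may be infinite. -/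
def realIoo (a b : EReal) : Set ℝ := {r : ℝ | a < (r : EReal) ∧ (r : EReal) < b}

/-- The filter of real numbers `r ∈ (a, b)` tending to `r₀ ∈ [a, b]`. -/
def nhdsIoo (a b r₀ : EReal) : Filter ℝ :=
  comap (fun r : ℝ => (r : EReal)) (𝓝[Ioo a b] r₀)

/-- The norm `(γ^{AC} γ^{BD} T_{AB} T_{CD})^{1/2}` of a bilinear form `T` with respect to an inner
product `γ` on `ℝ^d`. -/
def tensorNorm (γ T : EuclideanSpace ℝ (Fin d) →L[ℝ] EuclideanSpace ℝ (Fin d) →L[ℝ] ℝ) : ℝ :=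
  let γinv : Matrix (Fin d) (Fin d) ℝ :=
    (Matrix.of fun A B => γ (stdBasis d A) (stdBasis d B))⁻¹
  Real.sqrt (∑ A, ∑ B, ∑ C, ∑ D, γinv A C * γinv B D *
    T (stdBasis d A) (stdBasis d B) * T (stdBasis d C) (stdBasis d D))

/-- `dr² + G(r)` is asymptotic to `dr² + h(r)² Ĝ` at `r₀ ∈ [a, b]`: the norm of `G(r) - h(r)² Ĝ`
with respect to `h(r)² Ĝ` tends to zero, uniformly on `N`, as `r ∈ (a, b)` tends to `r₀`. -/
def AsymptoticAt (a b r₀ : EReal)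
    (G : ℝ → ∀ x : N, TangentSpace I x →L[ℝ] TangentSpace I x →L[ℝ] ℝ) (h : ℝ → ℝ)
    (Ghat : ∀ x : N, TangentSpace I x →L[ℝ] TangentSpace I x →L[ℝ] ℝ) : Prop :=
  ∀ ε : ℝ, 0 < ε → ∀ᶠ r in nhdsIoo a b r₀, ∀ x : N,
    tensorNorm (h r ^ 2 • Ghat x) (G r x - h r ^ 2 • Ghat x) < ε

/-- The tensor field `g` on `ℝ × N` is smooth on the set `s`. -/
def SmoothMetricOn [IsManifold I ∞ N]
    (g : ∀ p : ℝ × N, TangentSpace (𝓘(ℝ, ℝ).prod I) p →L[ℝ]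
    TangentSpace (𝓘(ℝ, ℝ).prod I) p →L[ℝ] ℝ) (s : Set (ℝ × N)) : Prop :=
  ContMDiffOn (𝓘(ℝ, ℝ).prod I)
    ((𝓘(ℝ, ℝ).prod I).prod 𝓘(ℝ, (ℝ × EuclideanSpace ℝ (Fin d)) →L[ℝ]
      (ℝ × EuclideanSpace ℝ (Fin d)) →L[ℝ] ℝ)) ∞
    (fun p => Bundle.TotalSpace.mk' ((ℝ × EuclideanSpace ℝ (Fin d)) →L[ℝ]
      (ℝ × EuclideanSpace ℝ (Fin d)) →L[ℝ] ℝ) p (g p)) s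

/-- Smooth Riemannian metrics on `N`. -/
abbrev Metric (N : Type*) [TopologicalSpace N] [ChartedSpace H N] [IsManifold I ∞ N] :=
  Bundle.ContMDiffRiemannianMetric I ∞ (EuclideanSpace ℝ (Fin d))
    (fun x : N => TangentSpace I x)

end Radial

end RadialMass

end

/-! Write S = ½ G⁻¹ ∂ᵣG for the Weingarten map, H = tr S and k = h'/h. For a metric dr² + G(r) the
Christoffel symbols with at least two indices r vanish and Γ^B_{Ar} = S^B_A, so the radial Ricci
curvature obeys the traced Riccati equation R_rr = -∂ᵣH - tr S² (`ricciRR_eq`). The background has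
S₀ = k·1. When m = h²(H₀ - H) is differentiated, the term 2hh'(H₀ - H) coming from the weight h² is
exactly what completes the square: ∂ᵣm = h²(R_rr - R⁰_rr) + h² tr (S - k)² (`radialMassDeriv_eq`).

Since S - k·1 = G⁻¹(½ ∂ᵣG - kG) with a symmetric form in the bracket, tr (S - k)² is a squared norm
with respect to G; it is nonnegative and vanishes only if ∂ᵣG = 2kG (`trace_shape_sub_sq`). The
identity is integrated along each line r ↦ (r, x) and then over N, so a boundary of N contributes
nothing (`monotonicity`). Equality forces the square to vanish everywhere, by continuity, and then
G/h² does not depend on r (`conformal_of_shapeDefect_eq_zero`). For such G the norm of G - h²Ĝ with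
respect to h²Ĝ is independent of r, so it can tend to 0 only if it is 0 (`eq_of_asymptoticAt`).

The remaining work is transfer between charts. The curvatures at a point are computed in the
preferred chart of that point; being traces, they agree with smooth expressions in any other chart.
The Riemannian measure is a supremum of chart measures, and is shown to be finite and positive on
nonempty open sets. -/

noncomputable section

namespace RadialMass

/-! ### Traces as squared norms, and congruence of matrices -/

section LinearAlgebra

variable {ι : Type*} [Fintype ι]

theorem trace_mul_transpose_self_eq_sum (X : Matrix ι ι ℝ) :
    (X * X.transpose).trace = ∑ i, ∑ j, X i j ^ 2 := by
  simp [Matrix.trace, Matrix.mul_apply, sq]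

variable [DecidableEq ι]

-- The positive matrix A⁻¹ is a square in the C⋆-algebra of matrices. Then L A Lᵀ = 1, so L K Lᵀ is
-- the form K written in a frame orthonormal for A.
open scoped MatrixOrder in
theorem exists_transpose_mul_self_eq_inv {A : Matrix ι ι ℝ} (hA : A.PosDef) :
    ∃ L : Matrix ι ι ℝ, A⁻¹ = L.transpose * L ∧ IsUnit L.det := by
  obtain ⟨L, hL⟩ := CStarAlgebra.nonneg_iff_eq_star_mul_self.mp hA.inv.posSemidef.nonneg
  rw [Matrix.star_eq_conjTranspose, Matrix.conjTranspose_eq_transpose_of_trivial] at hL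
  refine ⟨L, hL, ?_⟩
  have h := hA.inv.det_pos
  rw [hL, Matrix.det_mul, Matrix.det_transpose] at h
  exact isUnit_iff_ne_zero.2 fun h0 => by simp [h0] at h

theorem eq_zero_of_conj_eq_zero {L K : Matrix ι ι ℝ} (hL : IsUnit L.det)
    (h : L * K * L.transpose = 0) : K = 0 := by
  have hL' : IsUnit L.transpose.det := by rwa [Matrix.det_transpose]
  have h1 : L * K = 0 := by
    have := congrArg (fun X => X * L.transpose⁻¹) h
    simpa [Matrix.mul_nonsing_inv_cancel_right _ _ hL'] using this
  have := congrArg (fun X => L⁻¹ * X) h1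
  simpa [Matrix.nonsing_inv_mul_cancel_left _ _ hL] using this

/-- The square of the norm, with respect to the positive definite matrix `A`, of the bilinear form
of matrix `K`. -/
theorem trace_inv_mul_eq_sum {A L : Matrix ι ι ℝ} (hL : A⁻¹ = L.transpose * L)
    (K : Matrix ι ι ℝ) :
    (A⁻¹ * K * (A⁻¹ * K.transpose)).trace =
      ∑ i, ∑ j, (L * K * L.transpose) i j ^ 2 := by
  rw [← trace_mul_transpose_self_eq_sum, hL]
  rw [show L.transpose * L * K * (L.transpose * L * K.transpose)
    = L.transpose * (L * K * (L.transpose * L * K.transpose)) by simp only [Matrix.mul_assoc],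
    Matrix.trace_mul_comm]
  simp only [Matrix.transpose_mul, Matrix.transpose_transpose, Matrix.mul_assoc]

theorem trace_inv_mul_nonneg {A : Matrix ι ι ℝ} (hA : A.PosDef) (K : Matrix ι ι ℝ) :
    0 ≤ (A⁻¹ * K * (A⁻¹ * K.transpose)).trace := by
  obtain ⟨L, hL, -⟩ := exists_transpose_mul_self_eq_inv hA
  rw [trace_inv_mul_eq_sum hL]
  positivity

/-- A sum of squares of the entries of L K Lᵀ vanishes only if every entry does, and L is
invertible. This serves twice: for the equality case and for the asymptotic condition. -/
theorem eq_zero_of_trace_inv_mul_eq_zero {A : Matrix ι ι ℝ} (hA : A.PosDef) {K : Matrix ι ι ℝ}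
    (h : (A⁻¹ * K * (A⁻¹ * K.transpose)).trace = 0) : K = 0 := by
  obtain ⟨L, hL, hu⟩ := exists_transpose_mul_self_eq_inv hA
  rw [trace_inv_mul_eq_sum hL] at h
  refine eq_zero_of_conj_eq_zero hu ?_
  ext i j
  have h1 := (Finset.sum_eq_zero_iff_of_nonneg fun i _ => by positivity).1 h i (Finset.mem_univ i)
  have h2 := (Finset.sum_eq_zero_iff_of_nonneg fun i _ => by positivity).1 h1 j (Finset.mem_univ j)
  simpa using h2

/-- Congruent pairs of matrices have similar quotients. -/
theorem conj_inv_mul_conj {P A K : Matrix ι ι ℝ} (hP : IsUnit P.det) :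
    (P.transpose * A * P)⁻¹ * (P.transpose * K * P) = P⁻¹ * (A⁻¹ * K) * P := by
  have hP' : IsUnit P.transpose.det := by rwa [Matrix.det_transpose]
  rw [Matrix.mul_inv_rev, Matrix.mul_inv_rev]
  simp only [Matrix.mul_assoc]
  rw [Matrix.nonsing_inv_mul_cancel_left _ _ hP']

theorem trace_conj {P X : Matrix ι ι ℝ} (hP : IsUnit P.det) :
    (P⁻¹ * X * P).trace = X.trace := by
  rw [Matrix.trace_mul_comm, Matrix.mul_nonsing_inv_cancel_left _ _ hP]

theorem conj_mul_conj {P X Y : Matrix ι ι ℝ} (hP : IsUnit P.det) :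
    (P⁻¹ * X * P) * (P⁻¹ * Y * P) = P⁻¹ * (X * Y) * P := by
  simp only [Matrix.mul_assoc]
  rw [Matrix.mul_nonsing_inv_cancel_left _ _ hP]

end LinearAlgebra

/-! ### The tensor norm as a trace -/

section TensorNorm

variable {d : ℕ}

/-- Both sides are the same fourfold sum, up to its order and to one transposition of the indices of
A⁻¹; the latter is where symmetry enters. -/
theorem tensorNorm_eq (γ T : EuclideanSpace ℝ (Fin d) →L[ℝ] EuclideanSpace ℝ (Fin d) →L[ℝ] ℝ)
    {A K : Matrix (Fin d) (Fin d) ℝ}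
    (hA : A = Matrix.of fun i j => γ (stdBasis d i) (stdBasis d j))
    (hK : K = Matrix.of fun i j => T (stdBasis d i) (stdBasis d j)) (hs : A⁻¹.IsSymm) :
    tensorNorm γ T = Real.sqrt (A⁻¹ * K * (A⁻¹ * K.transpose)).trace := by
  subst hA hK
  rw [tensorNorm]
  congr 1
  set W := (Matrix.of fun i j => γ (stdBasis d i) (stdBasis d j))⁻¹
  simp only [Matrix.trace, Matrix.mul_apply, Matrix.diag_apply, Matrix.transpose_apply,
    Finset.sum_mul, Finset.mul_sum, Matrix.of_apply]
  calc ∑ a, ∑ b, ∑ c, ∑ e, W a c * W b e * T (stdBasis d a) (stdBasis d b) *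
          T (stdBasis d c) (stdBasis d e)
      = ∑ a, ∑ c, ∑ b, ∑ e, W a c * W b e * T (stdBasis d a) (stdBasis d b) *
          T (stdBasis d c) (stdBasis d e) :=
        Finset.sum_congr rfl fun a _ => Finset.sum_comm
    _ = ∑ c, ∑ a, ∑ b, ∑ e, W a c * W b e * T (stdBasis d a) (stdBasis d b) *
          T (stdBasis d c) (stdBasis d e) := Finset.sum_comm
    _ = ∑ c, ∑ b, ∑ a, ∑ e, W a c * W b e * T (stdBasis d a) (stdBasis d b) *
          T (stdBasis d c) (stdBasis d e) :=
        Finset.sum_congr rfl fun a _ => Finset.sum_comm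
    _ = ∑ c, ∑ b, ∑ e, ∑ a, W a c * W b e * T (stdBasis d a) (stdBasis d b) *
          T (stdBasis d c) (stdBasis d e) :=
        Finset.sum_congr rfl fun a _ => Finset.sum_congr rfl fun b _ => Finset.sum_comm
    _ = _ := by
        refine Finset.sum_congr rfl fun c _ => Finset.sum_congr rfl fun b _ =>
          Finset.sum_congr rfl fun e _ => Finset.sum_congr rfl fun a _ => ?_
        rw [hs.apply c a]
        ring

theorem ext_stdBasis {γ γ' : EuclideanSpace ℝ (Fin d) →L[ℝ] EuclideanSpace ℝ (Fin d) →L[ℝ] ℝ}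
    (h : ∀ i j, γ (stdBasis d i) (stdBasis d j) = γ' (stdBasis d i) (stdBasis d j)) : γ = γ' := by
  apply ContinuousLinearMap.coe_injective
  refine (stdBasis d).ext fun i => ?_
  apply ContinuousLinearMap.coe_injective
  exact (stdBasis d).ext fun j => h i j

end TensorNorm

/-! ### Smoothness of determinants and inverses -/

section Smooth

variable {E : Type*} [NormedAddCommGroup E] [NormedSpace ℝ E] {s : Set E} {k : WithTop ℕ∞}
  {ι : Type*} [Fintype ι] [DecidableEq ι] {A : E → Matrix ι ι ℝ}

theorem contDiffOn_matrix_det (hA : ∀ i j, ContDiffOn ℝ k (fun z => A z i j) s) :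
    ContDiffOn ℝ k (fun z => (A z).det) s := by
  simp_rw [Matrix.det_apply]
  refine ContDiffOn.sum fun σ _ => ContDiffOn.const_smul _ ?_
  exact contDiffOn_prod fun i _ => hA _ _

theorem contDiffOn_matrix_inv (hA : ∀ i j, ContDiffOn ℝ k (fun z => A z i j) s)
    (hdet : ∀ z ∈ s, (A z).det ≠ 0) (i j : ι) :
    ContDiffOn ℝ k (fun z => (A z)⁻¹ i j) s := by
  simp_rw [Matrix.inv_def, Ring.inverse_eq_inv', Matrix.smul_apply, smul_eq_mul]
  refine ((contDiffOn_matrix_det hA).inv hdet).mul ?_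
  simp_rw [Matrix.adjugate_apply]
  refine contDiffOn_matrix_det fun a b => ?_
  by_cases h : a = j
  · subst h; simp only [Matrix.updateRow_self]; exact contDiffOn_const
  · simp only [Matrix.updateRow_ne h]; exact hA a b

end Smooth

/-! ### Intervals with possibly infinite ends -/

section Interval

theorem isOpen_realIoo (a b : EReal) : IsOpen (realIoo a b) :=
  (isOpen_Ioo (a := a) (b := b)).preimage continuous_coe_real_ereal

theorem ordConnected_realIoo (a b : EReal) : OrdConnected (realIoo a b) :=
  ⟨fun _ hx _ hy _ hz => ⟨hx.1.trans_le (EReal.coe_le_coe_iff.2 hz.1),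
    (EReal.coe_le_coe_iff.2 hz.2).trans_lt hy.2⟩⟩

/-- The reals are dense in the extended line, so pulling neighbourhoods back to ℝ loses nothing,
even when `r₀` is infinite. -/
theorem nhdsIoo_neBot {a b r₀ : EReal} (hab : a < b) (hr : r₀ ∈ Icc a b) :
    (nhdsIoo a b r₀).NeBot := by
  refine comap_neBot_iff.2 fun t ht => ?_
  obtain ⟨u, hu, hr₀u, hut⟩ := mem_nhdsWithin.1 ht
  have hcl : r₀ ∈ closure (Ioo a b) := by rwa [closure_Ioo hab.ne]
  obtain ⟨y, hyu, hy⟩ := mem_closure_iff.1 hcl u hu hr₀u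
  obtain ⟨l, w, hlw, hlwu⟩ := (mem_nhds_iff_exists_Ioo_subset' ⟨a, hy.1⟩ ⟨b, hy.2⟩).1
    ((hu.inter isOpen_Ioo).mem_nhds ⟨hyu, hy⟩)
  obtain ⟨z, hz⟩ := EReal.lt_iff_exists_real_btwn.1 hlw.1
  exact ⟨z, hut (hlwu ⟨hz.1, hz.2.trans hlw.2⟩)⟩

theorem mem_nhdsIoo (a b r₀ : EReal) : realIoo a b ∈ nhdsIoo a b r₀ :=
  mem_comap.2 ⟨Ioo a b, self_mem_nhdsWithin, fun _ h => h⟩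

instance (a b r₀ : EReal) : (nhdsIoo a b r₀).IsCountablyGenerated := by
  unfold nhdsIoo; infer_instance

theorem exists_seq_nhdsIoo {a b : EReal} (hab : a < b) : ∃ u v : ℕ → ℝ,
    (∀ k, u k ∈ realIoo a b) ∧ (∀ k, v k ∈ realIoo a b) ∧
    Tendsto u atTop (nhdsIoo a b a) ∧ Tendsto v atTop (nhdsIoo a b b) ∧
    ∀ r ∈ realIoo a b, ∀ᶠ k in atTop, u k < r ∧ r < v k := by
  have aux : ∀ r₀ ∈ Icc a b, ∃ u : ℕ → ℝ, (∀ k, u k ∈ realIoo a b) ∧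
      Tendsto u atTop (nhdsIoo a b r₀) := by
    intro r₀ hr₀
    have := nhdsIoo_neBot hab hr₀
    obtain ⟨u, hu⟩ := exists_seq_tendsto (nhdsIoo a b r₀)
    -- The sequence lies in (a, b) only eventually; dropping its first terms makes this true for
    -- every index.
    obtain ⟨k, hk⟩ := eventually_atTop.1 (hu (mem_nhdsIoo a b r₀))
    exact ⟨fun j => u (j + k), fun j => hk _ (Nat.le_add_left _ _),
      hu.comp (tendsto_add_atTop_nat k)⟩
  obtain ⟨u, hu, hua⟩ := aux a ⟨le_rfl, hab.le⟩
  obtain ⟨v, hv, hvb⟩ := aux b ⟨hab.le, le_rfl⟩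
  refine ⟨u, v, hu, hv, hua, hvb, fun r hr => ?_⟩
  have h1 := (tendsto_comap_iff.1 hua).mono_right nhdsWithin_le_nhds
  have h2 := (tendsto_comap_iff.1 hvb).mono_right nhdsWithin_le_nhds
  filter_upwards [h1.eventually_lt_const hr.1, h2.eventually_const_lt hr.2] with k hk1 hk2
  exact ⟨EReal.coe_lt_coe_iff.1 hk1, EReal.coe_lt_coe_iff.1 hk2⟩

end Interval

/-! ### Integration of the derivative identity -/

section Monotonicity

variable {N : Type*} [TopologicalSpace N] [CompactSpace N] [T2Space N]
  [SecondCountableTopology N]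
  [MeasurableSpace N] [BorelSpace N] {μ : Measure N} [IsFiniteMeasure μ]

theorem integrableOn_Icc_prod_univ {a b : EReal} {F : ℝ × N → ℝ}
    (hF : ContinuousOn F (realIoo a b ×ˢ univ)) {u v : ℝ} (hu : u ∈ realIoo a b)
    (hv : v ∈ realIoo a b) : IntegrableOn F (Icc u v ×ˢ univ) (volume.prod μ) :=
  (hF.mono (prod_mono ((ordConnected_realIoo a b).out hu hv) subset_rfl)).integrableOn_compact
    (isCompact_Icc.prod isCompact_univ)

theorem integrable_slice {a b : EReal} {F : ℝ × N → ℝ}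
    (hF : ContinuousOn F (realIoo a b ×ˢ univ)) {r : ℝ} (hr : r ∈ realIoo a b) :
    Integrable (fun x => F (r, x)) μ := by
  have h : Continuous fun x => F (r, x) :=
    hF.comp_continuous (by fun_prop) fun x => ⟨hr, mem_univ x⟩
  simpa using h.continuousOn.integrableOn_compact isCompact_univ

/-- The fundamental theorem of calculus on each line r ↦ (r, x), followed by Fubini on the compact
slab [u, v] × N. Nothing is differentiated along N. -/
theorem integral_sub_eq_setIntegral_deriv {a b : EReal} {m F : ℝ × N → ℝ}
    (hm : ContinuousOn m (realIoo a b ×ˢ univ)) (hF : ContinuousOn F (realIoo a b ×ˢ univ))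
    (hderiv : ∀ r ∈ realIoo a b, ∀ x, HasDerivAt (fun t => m (t, x)) (F (r, x)) r)
    {u v : ℝ} (hu : u ∈ realIoo a b) (hv : v ∈ realIoo a b) (huv : u ≤ v) :
    (∫ x, m (v, x) ∂μ) - ∫ x, m (u, x) ∂μ = ∫ p in Icc u v ×ˢ univ, F p ∂(volume.prod μ) := by
  have hint := integrableOn_Icc_prod_univ (μ := μ) hF hu hv
  have hsub := (ordConnected_realIoo a b).out hu hv
  rw [IntegrableOn, ← Measure.prod_restrict, Measure.restrict_univ] at hint
  rw [← Measure.prod_restrict, Measure.restrict_univ, integral_prod_symm _ hint,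
    ← integral_sub (integrable_slice hm hv) (integrable_slice hm hu)]
  refine integral_congr_ae (Eventually.of_forall fun x => ?_)
  have hc : ContinuousOn (fun r => F (r, x)) (Icc u v) :=
    hF.comp (by fun_prop) fun r hr => ⟨hsub hr, mem_univ x⟩
  have := intervalIntegral.integral_eq_sub_of_hasDerivAt (a := u) (b := v)
    (f := fun t => m (t, x)) (f' := fun t => F (t, x))
    (fun r hr => hderiv r (hsub (by rwa [uIcc_of_le huv] at hr)) x)
    (ContinuousOn.intervalIntegrable (by rwa [uIcc_of_le huv]))
  simp only
  rw [← this, intervalIntegral.integral_of_le huv, integral_Icc_eq_integral_Ioc]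

/-- If `∂ᵣ m = D + Q` with `Q` nonnegative, then the increase of `∫ m` is that of `D` and `Q`. -/
theorem sub_eq_integral_add_integral {a b : EReal} (hab : a < b) {m F D Q : ℝ × N → ℝ}
    (hm : ContinuousOn m (realIoo a b ×ˢ univ)) (hF : ContinuousOn F (realIoo a b ×ˢ univ))
    (hQ : ContinuousOn Q (realIoo a b ×ˢ univ))
    (hderiv : ∀ r ∈ realIoo a b, ∀ x, HasDerivAt (fun t => m (t, x)) (F (r, x)) r)
    (hFDQ : ∀ p ∈ realIoo a b ×ˢ univ, F p = D p + Q p)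
    (hQ0 : ∀ p ∈ realIoo a b ×ˢ univ, 0 ≤ Q p) {Ma Mb : ℝ}
    (hMa : Tendsto (fun r => ∫ x, m (r, x) ∂μ) (nhdsIoo a b a) (𝓝 Ma))
    (hMb : Tendsto (fun r => ∫ x, m (r, x) ∂μ) (nhdsIoo a b b) (𝓝 Mb))
    (hD : IntegrableOn D (realIoo a b ×ˢ univ) (volume.prod μ)) :
    IntegrableOn Q (realIoo a b ×ˢ univ) (volume.prod μ) ∧
    Mb - Ma = (∫ p in realIoo a b ×ˢ univ, D p ∂(volume.prod μ)) +
      ∫ p in realIoo a b ×ˢ univ, Q p ∂(volume.prod μ) := by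
  obtain ⟨u, v, hu, hv, hua, hvb, huv⟩ := exists_seq_nhdsIoo hab
  set M : Set (ℝ × N) := realIoo a b ×ˢ univ with hMdef
  set ν : Measure (ℝ × N) := (volume.prod μ).restrict M with hν
  have hMm : MeasurableSet M := (isOpen_realIoo a b).measurableSet.prod MeasurableSet.univ
  have hsub : ∀ k, Icc (u k) (v k) ×ˢ univ ⊆ M := fun k =>
    prod_mono ((ordConnected_realIoo a b).out (hu k) (hv k)) subset_rfl
  have hcover : AECover ν atTop fun k => Icc (u k) (v k) ×ˢ (univ : Set N) := by
    refine ⟨?_, fun k => measurableSet_Icc.prod MeasurableSet.univ⟩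
    filter_upwards [ae_restrict_mem hMm] with p hp
    filter_upwards [huv p.1 hp.1] with k hk
    exact ⟨⟨hk.1.le, hk.2.le⟩, mem_univ _⟩
  have hres : ∀ k, ν.restrict (Icc (u k) (v k) ×ˢ univ)
      = (volume.prod μ).restrict (Icc (u k) (v k) ×ˢ univ) := fun k => by
    rw [hν, Measure.restrict_restrict (hcover.measurableSet k), inter_eq_left.2 (hsub k)]
  have hQi : ∀ k, IntegrableOn Q (Icc (u k) (v k) ×ˢ univ) ν := fun k => by
    rw [IntegrableOn, hres]; exact integrableOn_Icc_prod_univ hQ (hu k) (hv k)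
  have hDlim := hcover.integral_tendsto_of_countably_generated hD
  -- On each slab the integral of Q is the increment of ∫ m minus the integral of D. Both converge
  -- along the exhaustion.
  have hQlim : Tendsto (fun k => ∫ p in Icc (u k) (v k) ×ˢ univ, Q p ∂ν) atTop
      (𝓝 (Mb - Ma - ∫ p, D p ∂ν)) := by
    refine (((hMb.comp hvb).sub (hMa.comp hua)).sub hDlim).congr' ?_
    obtain ⟨r, hr⟩ := EReal.lt_iff_exists_real_btwn.1 hab
    filter_upwards [huv r hr] with k hk
    simp only [Function.comp]
    rw [integral_sub_eq_setIntegral_deriv hm hF hderiv (hu k) (hv k) (hk.1.trans hk.2).le, ← hres,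
      setIntegral_congr_fun (g := fun p => D p + Q p) (hcover.measurableSet k)
        (fun p hp => hFDQ p (hsub k hp)), integral_add hD.integrableOn (hQi k)]
    ring
  have hnn : ∀ᵐ p ∂ν, 0 ≤ Q p := by
    filter_upwards [ae_restrict_mem hMm] with p hp using hQ0 p hp
  -- Integrability of Q is not assumed: for a nonnegative function, convergence of the integrals
  -- over an exhaustion yields it.
  have hQint := hcover.integrable_of_integral_tendsto_of_nonneg_ae _ hQi hnn hQlim
  have := hcover.integral_eq_of_tendsto _ hQint hQlim
  exact ⟨hQint, by rw [this]; ring⟩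

/-- The gap in the inequality is ∫ Q. If it is zero, then Q vanishes almost everywhere, hence
everywhere on the open set, since Q is continuous and the product measure charges nonempty open
sets. -/
theorem monotonicity {a b : EReal} (hab : a < b) [μ.IsOpenPosMeasure] {m F D Q : ℝ × N → ℝ}
    (hm : ContinuousOn m (realIoo a b ×ˢ univ)) (hF : ContinuousOn F (realIoo a b ×ˢ univ))
    (hQ : ContinuousOn Q (realIoo a b ×ˢ univ))
    (hderiv : ∀ r ∈ realIoo a b, ∀ x, HasDerivAt (fun t => m (t, x)) (F (r, x)) r)
    (hFDQ : ∀ p ∈ realIoo a b ×ˢ univ, F p = D p + Q p)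
    (hQ0 : ∀ p ∈ realIoo a b ×ˢ univ, 0 ≤ Q p) {Ma Mb : ℝ}
    (hMa : Tendsto (fun r => ∫ x, m (r, x) ∂μ) (nhdsIoo a b a) (𝓝 Ma))
    (hMb : Tendsto (fun r => ∫ x, m (r, x) ∂μ) (nhdsIoo a b b) (𝓝 Mb))
    (hD : IntegrableOn D (realIoo a b ×ˢ univ) (volume.prod μ)) :
    Mb - Ma ≥ ∫ p in realIoo a b ×ˢ univ, D p ∂(volume.prod μ) ∧
    (Mb - Ma = ∫ p in realIoo a b ×ˢ univ, D p ∂(volume.prod μ) ↔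
      ∀ p ∈ realIoo a b ×ˢ univ, Q p = 0) := by
  obtain ⟨hQint, heq⟩ :=
    sub_eq_integral_add_integral hab hm hF hQ hderiv hFDQ hQ0 hMa hMb hD
  have hMo : IsOpen (realIoo a b ×ˢ (univ : Set N)) := (isOpen_realIoo a b).prod isOpen_univ
  have hnn : 0 ≤ᵐ[(volume.prod μ).restrict (realIoo a b ×ˢ univ)] Q := by
    filter_upwards [ae_restrict_mem hMo.measurableSet] with p hp using hQ0 p hp
  refine ⟨?_, ?_, fun h => ?_⟩
  · rw [heq]; linarith [integral_nonneg_of_ae hnn]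
  · intro h
    have h0 : ∫ p in realIoo a b ×ˢ univ, Q p ∂(volume.prod μ) = 0 := by linarith
    rw [integral_eq_zero_iff_of_nonneg_ae hnn hQint] at h0
    exact Measure.eqOn_open_of_ae_eq h0 hMo hQ continuousOn_const
  · rw [heq, setIntegral_congr_fun hMo.measurableSet (g := fun _ => (0 : ℝ)) h]
    simp

end Monotonicity

/-! ### Coordinate frames and metric components in charts -/

section CoordinateFrames

variable {V : Type*} [NormedAddCommGroup V] [NormedSpace ℝ V]
  {H : Type*} [TopologicalSpace H] {I : ModelWithCorners ℝ V H}
  {M : Type*} [TopologicalSpace M] [ChartedSpace H M] [IsManifold I ∞ M]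
  {ι : Type*} {b : Module.Basis ι ℝ V}

/-- This identifies the concrete ∂ᵢ with the local frame of the tangent bundle trivialization, whose
smoothness is known; smoothness of metric components follows by pairing. -/
theorem coordVec_eq_localFrame {p : M} {z : V} (hz : z ∈ (extChartAt I p).target) (i : ι) :
    coordVec I b p z i =
      (trivializationAt V (TangentSpace I) p).localFrame b i ((extChartAt I p).symm z) := by
  have : IsManifold I 1 M := .of_le (n := ∞) (by simp)
  have hs : (extChartAt I p).symm z ∈ (chartAt H p).source := by
    rw [← extChartAt_source (I := I)]; exact (extChartAt I p).map_target hz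
  have hb : (extChartAt I p).symm z ∈ (trivializationAt V (TangentSpace I) p).baseSet := by
    simpa using hs
  rw [Bundle.Trivialization.localFrame_apply_of_mem_baseSet _ _ hb, Bundle.Trivialization.basisAt,
    Module.Basis.map_apply]
  have h := congrArg (fun f => f (b i)) (TangentBundle.symmL_trivializationAt (𝕜 := ℝ) (I := I) hs)
  rw [(extChartAt I p).right_inv hz] at h
  refine h.symm.trans ?_
  rw [Bundle.Trivialization.symmL_apply _ hb]
  rfl

theorem contDiffOn_coordMatrix
    {g : ∀ q : M, TangentSpace I q →L[ℝ] TangentSpace I q →L[ℝ] ℝ} {s : Set M}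
    (hg : ContMDiffOn I (I.prod 𝓘(ℝ, V →L[ℝ] V →L[ℝ] ℝ)) ∞
      (fun q => Bundle.TotalSpace.mk' (V →L[ℝ] V →L[ℝ] ℝ) q (g q)) s) (p : M) (i j : ι) :
    ContDiffOn ℝ ∞ (fun z => coordMatrix I b g p z i j)
      ((extChartAt I p).target ∩ (extChartAt I p).symm ⁻¹' s) := by
  set e := trivializationAt V (TangentSpace I : M → Type _) p
  have hbase : e.baseSet = (extChartAt I p).source := by
    simp [e]
  have hfr : ∀ k, ContMDiffOn I (I.prod 𝓘(ℝ, V)) ∞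
      (fun q => Bundle.TotalSpace.mk' V q (e.localFrame b k q)) ((extChartAt I p).source ∩ s) :=
    fun k => (hbase ▸ e.contMDiffOn_localFrame_baseSet ∞ b k).mono inter_subset_left
  have h1 := (hg.mono (inter_subset_right (s := (extChartAt I p).source))).clm_bundle_apply₂
    (hfr i) (hfr j)
  have h2 : ContMDiffOn I 𝓘(ℝ, ℝ) ∞ (fun q => g q (e.localFrame b i q) (e.localFrame b j q))
      ((extChartAt I p).source ∩ s) := fun q hq =>
    (Bundle.contMDiffWithinAt_totalSpace.1 (h1 q hq)).2
  have h3 : ContMDiffOn 𝓘(ℝ, V) I ∞ (extChartAt I p).symm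
      ((extChartAt I p).target ∩ (extChartAt I p).symm ⁻¹' s) :=
    (contMDiffOn_extChartAt_symm p).mono inter_subset_left
  have h4 := h2.comp h3 fun z hz => ⟨(extChartAt I p).map_target hz.1, hz.2⟩
  refine (contMDiffOn_iff_contDiffOn.1 h4).congr fun z hz => ?_
  simp only [coordMatrix, Matrix.of_apply, coordVec_eq_localFrame hz.1]
  rfl

/-- The differential of the inverse chart around `p`, at the coordinates of `x`, as an automorphism
of the model space. -/
theorem exists_equiv_coordVec_eq {p x : M} (hx : x ∈ (extChartAt I p).source) :
    ∃ L : V ≃L[ℝ] V, ∀ i, (coordVec I b p (extChartAt I p x) i : V) = L (b i) := by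
  have : IsManifold I 1 M := .of_le (n := ∞) (by simp)
  obtain ⟨L, hL⟩ := isInvertible_mfderivWithin_extChartAt_symm (I := I)
    ((extChartAt I p).map_source hx)
  refine ⟨L, fun i => ?_⟩
  rw [coordVec, ← hL]
  rfl

end CoordinateFrames

/-! ### Product charts and the block form of the metric -/

section RadialFrames

variable {d : ℕ} {H : Type*} [TopologicalSpace H]
  {I : ModelWithCorners ℝ (EuclideanSpace ℝ (Fin d)) H}
  {N : Type*} [TopologicalSpace N] [ChartedSpace H N]

theorem range_radial : range (𝓘(ℝ, ℝ).prod I) = univ ×ˢ range I := by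
  rw [ModelWithCorners.range_prod, ModelWithCorners.range_eq_univ]

variable [IsManifold I ∞ N]

/-- The preferred chart of ℝ × N is the identity times a chart of N, so its inverse is
differentiated factor by factor. -/
theorem mfderivWithin_radial_symm {p : ℝ × N} {z : ℝ × EuclideanSpace ℝ (Fin d)}
    (hz : z.2 ∈ (extChartAt I p.2).target) (v : ℝ × EuclideanSpace ℝ (Fin d)) :
    (mfderivWithin 𝓘(ℝ, ℝ × EuclideanSpace ℝ (Fin d)) (𝓘(ℝ, ℝ).prod I)
      (extChartAt (𝓘(ℝ, ℝ).prod I) p).symm (range (𝓘(ℝ, ℝ).prod I)) z v :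
        ℝ × EuclideanSpace ℝ (Fin d)) =
      (v.1, mfderivWithin 𝓘(ℝ, EuclideanSpace ℝ (Fin d)) I
        (extChartAt I p.2).symm (range I) z.2 v.2) := by
  have : IsManifold I 1 N := .of_le (n := ∞) (by simp)
  have hr : z ∈ range (𝓘(ℝ, ℝ).prod I) := by
    rw [range_radial]; exact ⟨mem_univ _, extChartAt_target_subset_range _ hz⟩
  have h1 : HasMFDerivWithinAt 𝓘(ℝ, ℝ × EuclideanSpace ℝ (Fin d)) 𝓘(ℝ, ℝ)
      (fun z : ℝ × EuclideanSpace ℝ (Fin d) => z.1) (range (𝓘(ℝ, ℝ).prod I)) z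
      (ContinuousLinearMap.fst ℝ ℝ (EuclideanSpace ℝ (Fin d))) :=
    hasFDerivAt_fst.hasFDerivWithinAt.hasMFDerivWithinAt
  have h2 : HasMFDerivWithinAt 𝓘(ℝ, ℝ × EuclideanSpace ℝ (Fin d)) 𝓘(ℝ, EuclideanSpace ℝ (Fin d))
      (fun z : ℝ × EuclideanSpace ℝ (Fin d) => z.2) (range (𝓘(ℝ, ℝ).prod I)) z
      (ContinuousLinearMap.snd ℝ ℝ (EuclideanSpace ℝ (Fin d))) :=
    hasFDerivAt_snd.hasFDerivWithinAt.hasMFDerivWithinAt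
  have h3 := (mdifferentiableWithinAt_extChartAt_symm hz).hasMFDerivWithinAt
  have h4 := HasMFDerivWithinAt.comp z h3 h2 fun y hy => by
    rw [range_radial] at hy; exact hy.2
  have h5 := h1.prodMk h4
  have h6 := h5.mfderivWithin
    ((𝓘(ℝ, ℝ).prod I).uniqueDiffOn.uniqueMDiffOn z hr)
  exact congrArg (fun f => f v) h6

theorem coordVec_radial_inl {p : ℝ × N} {z : ℝ × EuclideanSpace ℝ (Fin d)}
    (hz : z.2 ∈ (extChartAt I p.2).target) :
    (coordVec (𝓘(ℝ, ℝ).prod I) (radialBasis d) p z (Sum.inl ()) :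
      ℝ × EuclideanSpace ℝ (Fin d)) = (1, 0) := by
  refine (mfderivWithin_radial_symm hz _).trans ?_
  have h : radialBasis d (Sum.inl ()) = (1, 0) := by simp [radialBasis]
  rw [h]
  exact congrArg (Prod.mk (1 : ℝ)) (map_zero _)

theorem coordVec_radial_inr {p : ℝ × N} {z : ℝ × EuclideanSpace ℝ (Fin d)}
    (hz : z.2 ∈ (extChartAt I p.2).target) (A : Fin d) :
    (coordVec (𝓘(ℝ, ℝ).prod I) (radialBasis d) p z (Sum.inr A) :
      ℝ × EuclideanSpace ℝ (Fin d)) = (0, coordVec I (stdBasis d) p.2 z.2 A) := by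
  refine (mfderivWithin_radial_symm hz _).trans ?_
  have h : radialBasis d (Sum.inr A) = (0, stdBasis d A) := by simp [radialBasis]
  rw [h]
  rfl

variable {G : ℝ → ∀ x : N, TangentSpace I x →L[ℝ] TangentSpace I x →L[ℝ] ℝ}

theorem coordMatrix_radial {p : ℝ × N} {z : ℝ × EuclideanSpace ℝ (Fin d)}
    (hz : z.2 ∈ (extChartAt I p.2).target) :
    coordMatrix (𝓘(ℝ, ℝ).prod I) (radialBasis d) (radialMetric I G) p z =
      Matrix.fromBlocks 1 0 0 (coordMatrix I (stdBasis d) (G z.1) p.2 z.2) := by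
  -- Naming the form on the fixed model space removes its dependence on the base point, so that the
  -- coordinate vectors can be rewritten inside it.
  obtain ⟨γ, hγ⟩ : ∃ γ : EuclideanSpace ℝ (Fin d) →L[ℝ] EuclideanSpace ℝ (Fin d) →L[ℝ] ℝ,
      γ = G z.1 ((extChartAt I p.2).symm z.2) := ⟨_, rfl⟩
  have key : ∀ v w : ℝ × EuclideanSpace ℝ (Fin d),
      radialMetric I G ((extChartAt (𝓘(ℝ, ℝ).prod I) p).symm z) v w =
        v.1 * w.1 + γ v.2 w.2 := by subst hγ; exact fun _ _ => rfl
  have hl := coordVec_radial_inl hz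
  have hr := coordVec_radial_inr hz
  ext (i | i) (j | j) <;> refine (key _ _).trans ?_
  · rw [hl]; simp
  · rw [hl, hr]; simp; rfl
  · rw [hl, hr]; simp
  · rw [hr, hr, hγ]; simp [coordMatrix]; rfl

end RadialFrames

/-! ### Coordinate derivatives on J × chart domain -/

section RadialCalculus

variable {d : ℕ} {H : Type*} [TopologicalSpace H]
  {I : ModelWithCorners ℝ (EuclideanSpace ℝ (Fin d)) H}
  {N : Type*} [TopologicalSpace N] [ChartedSpace H N]
  {J : Set ℝ} {x₀ : N} {z : ℝ × EuclideanSpace ℝ (Fin d)} {f f' : ℝ × EuclideanSpace ℝ (Fin d) → ℝ}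

theorem uniqueDiffOn_prod_target (hJ : IsOpen J) (x₀ : N) :
    UniqueDiffOn ℝ (J ×ˢ (extChartAt I x₀).target) :=
  hJ.uniqueDiffOn.prod (uniqueDiffOn_extChartAt_target x₀)

theorem prod_target_mem_nhdsWithin (hJ : IsOpen J) (hz : z ∈ J ×ˢ (extChartAt I x₀).target) :
    J ×ˢ (extChartAt I x₀).target ∈ 𝓝[range (𝓘(ℝ, ℝ).prod I)] z := by
  rw [range_radial, nhdsWithin_prod_eq, nhdsWithin_univ]
  exact prod_mem_prod (hJ.mem_nhds hz.1) (extChartAt_target_mem_nhdsWithin_of_mem hz.2)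

theorem prod_target_subset_range : J ×ˢ (extChartAt I x₀).target ⊆ range (𝓘(ℝ, ℝ).prod I) := by
  rw [range_radial]
  exact prod_mono (subset_univ _) (extChartAt_target_subset_range x₀)

theorem coordDeriv_congr (hJ : IsOpen J) (hz : z ∈ J ×ˢ (extChartAt I x₀).target)
    (h : EqOn f f' (J ×ˢ (extChartAt I x₀).target)) (i : Unit ⊕ Fin d) :
    coordDeriv (𝓘(ℝ, ℝ).prod I) (radialBasis d) i f z =
      coordDeriv (𝓘(ℝ, ℝ).prod I) (radialBasis d) i f' z := by
  rw [coordDeriv, coordDeriv, Filter.EventuallyEq.fderivWithin_eq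
    (h.eventuallyEq_of_mem (prod_target_mem_nhdsWithin hJ hz)) (h hz)]

theorem coordDeriv_eq_zero (hJ : IsOpen J) (hz : z ∈ J ×ˢ (extChartAt I x₀).target) {c : ℝ}
    (h : ∀ y ∈ J ×ˢ (extChartAt I x₀).target, f y = c) (i : Unit ⊕ Fin d) :
    coordDeriv (𝓘(ℝ, ℝ).prod I) (radialBasis d) i f z = 0 := by
  rw [coordDeriv_congr hJ hz (f' := fun _ => c) h]
  simp [coordDeriv]

theorem coordDeriv_eq (hJ : IsOpen J) (hz : z ∈ J ×ˢ (extChartAt I x₀).target)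
    (hf : DifferentiableWithinAt ℝ f (J ×ˢ (extChartAt I x₀).target) z) (i : Unit ⊕ Fin d) :
    coordDeriv (𝓘(ℝ, ℝ).prod I) (radialBasis d) i f z =
      fderivWithin ℝ f (J ×ˢ (extChartAt I x₀).target) z (radialBasis d i) := by
  rw [coordDeriv, fderivWithin_of_mem_nhdsWithin (prod_target_mem_nhdsWithin hJ hz)
    ((𝓘(ℝ, ℝ).prod I).uniqueDiffOn z (prod_target_subset_range hz)) hf]

theorem contDiffOn_coordDeriv (hJ : IsOpen J)
    (hf : ContDiffOn ℝ ∞ f (J ×ˢ (extChartAt I x₀).target)) (i : Unit ⊕ Fin d) :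
    ContDiffOn ℝ ∞ (coordDeriv (𝓘(ℝ, ℝ).prod I) (radialBasis d) i f)
      (J ×ˢ (extChartAt I x₀).target) := by
  have h1 := hf.fderivWithin (m := ∞) (uniqueDiffOn_prod_target hJ x₀) (by simp)
  refine (h1.clm_apply (contDiffOn_const (c := radialBasis d i))).congr fun z hz => ?_
  exact coordDeriv_eq hJ hz (hf.differentiableOn (by simp) z hz) i

/-- The boundary of N does not obstruct the r-direction: J is open, so the derivative within the set
restricts to a two-sided derivative in r. -/
theorem hasDerivAt_radial (hJ : IsOpen J) (hz : z ∈ J ×ˢ (extChartAt I x₀).target)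
    (hf : DifferentiableWithinAt ℝ f (J ×ˢ (extChartAt I x₀).target) z) :
    HasDerivAt (fun t => f (t, z.2))
      (coordDeriv (𝓘(ℝ, ℝ).prod I) (radialBasis d) (Sum.inl ()) f z) z.1 := by
  rw [coordDeriv_eq hJ hz hf]
  have hb : radialBasis d (Sum.inl ()) = (1, 0) := by simp [radialBasis]
  have hl : HasDerivWithinAt (fun t : ℝ => (t, z.2)) (radialBasis d (Sum.inl ())) J z.1 := by
    rw [hb]
    exact (hasDerivWithinAt_id _ _).prodMk (hasDerivWithinAt_const _ _ _)
  have := hf.hasFDerivWithinAt.comp_hasDerivWithinAt (t := J ×ˢ (extChartAt I x₀).target) z.1 hl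
    fun t ht => ⟨ht, hz.2⟩
  exact this.hasDerivAt (hJ.mem_nhds hz.1)

end RadialCalculus

/-! ### Christoffel symbols and the Riccati equation in a chart -/

section RadialCurvature

variable {d : ℕ} {H : Type*} [TopologicalSpace H]
  {I : ModelWithCorners ℝ (EuclideanSpace ℝ (Fin d)) H}
  {N : Type*} [TopologicalSpace N] [ChartedSpace H N]

/-- A family `G(r)`, `r ∈ J`, of bilinear forms on the tangent spaces of `N` is smooth if its
components in every chart are smooth functions of `r` and of the coordinates. -/
def IsSmoothFamily (I : ModelWithCorners ℝ (EuclideanSpace ℝ (Fin d)) H) (J : Set ℝ)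
    (G : ℝ → ∀ x : N, TangentSpace I x →L[ℝ] TangentSpace I x →L[ℝ] ℝ) : Prop :=
  ∀ (x₀ : N) (i j : Fin d), ContDiffOn ℝ ∞
    (fun z : ℝ × EuclideanSpace ℝ (Fin d) => coordMatrix I (stdBasis d) (G z.1) x₀ z.2 i j)
    (J ×ˢ (extChartAt I x₀).target)

/-- The matrix `½ G^{BC} ∂ᵣ G_{AC}` in the chart around `x₀`. -/
def chartShape (I : ModelWithCorners ℝ (EuclideanSpace ℝ (Fin d)) H)
    (G : ℝ → ∀ x : N, TangentSpace I x →L[ℝ] TangentSpace I x →L[ℝ] ℝ) (x₀ : N)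
    (z : ℝ × EuclideanSpace ℝ (Fin d)) : Matrix (Fin d) (Fin d) ℝ :=
  (1 / 2 : ℝ) • ((coordMatrix I (stdBasis d) (G z.1) x₀ z.2)⁻¹ *
    (Matrix.of fun A C => coordDeriv (𝓘(ℝ, ℝ).prod I) (radialBasis d) (Sum.inl ())
      (fun y => coordMatrix I (stdBasis d) (G y.1) x₀ y.2 A C) z).transpose)

variable {J : Set ℝ} {x₀ : N} {z : ℝ × EuclideanSpace ℝ (Fin d)}
  {G : ℝ → ∀ x : N, TangentSpace I x →L[ℝ] TangentSpace I x →L[ℝ] ℝ}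

theorem contDiffOn_chartShape (hJ : IsOpen J) (hG : IsSmoothFamily I J G)
    (hdet : ∀ z ∈ J ×ˢ (extChartAt I x₀).target,
      (coordMatrix I (stdBasis d) (G z.1) x₀ z.2).det ≠ 0) (i j : Fin d) :
    ContDiffOn ℝ ∞ (fun z => chartShape I G x₀ z i j) (J ×ˢ (extChartAt I x₀).target) := by
  simp only [chartShape, Matrix.smul_apply, Matrix.mul_apply, Matrix.transpose_apply,
    Matrix.of_apply, smul_eq_mul]
  refine contDiffOn_const.mul (ContDiffOn.sum fun k _ => ?_)
  exact (contDiffOn_matrix_inv (hG x₀) hdet i k).mul (contDiffOn_coordDeriv hJ (hG x₀ j k) _)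

variable [IsManifold I ∞ N]

theorem fromBlocks_one_inv {M : Matrix (Fin d) (Fin d) ℝ} (hM : M.det ≠ 0) :
    (Matrix.fromBlocks (1 : Matrix Unit Unit ℝ) 0 0 M)⁻¹ = Matrix.fromBlocks 1 0 0 M⁻¹ := by
  refine Matrix.inv_eq_right_inv ?_
  rw [Matrix.fromBlocks_multiply]
  simp [Matrix.mul_nonsing_inv _ (isUnit_iff_ne_zero.2 hM)]

section Christoffel

variable {p : ℝ × N}

theorem coordDeriv_coordMatrix_inl_left (hJ : IsOpen J)
    (hz : z ∈ J ×ˢ (extChartAt I p.2).target) (k i : Unit ⊕ Fin d) :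
    coordDeriv (𝓘(ℝ, ℝ).prod I) (radialBasis d) k (fun y =>
      coordMatrix (𝓘(ℝ, ℝ).prod I) (radialBasis d) (radialMetric I G) p y (Sum.inl ()) i) z = 0 := by
  -- The row of r in the block matrix does not see the lower block, so an identity block can stand
  -- in for it to name the constant.
  refine coordDeriv_eq_zero hJ hz
    (c := Matrix.fromBlocks (1 : Matrix Unit Unit ℝ) 0 0 (1 : Matrix (Fin d) (Fin d) ℝ)
      (Sum.inl ()) i) (fun y hy => ?_) k
  rw [coordMatrix_radial hy.2]
  cases i <;> simp

theorem coordDeriv_coordMatrix_inl_right (hJ : IsOpen J)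
    (hz : z ∈ J ×ˢ (extChartAt I p.2).target) (k i : Unit ⊕ Fin d) :
    coordDeriv (𝓘(ℝ, ℝ).prod I) (radialBasis d) k (fun y =>
      coordMatrix (𝓘(ℝ, ℝ).prod I) (radialBasis d) (radialMetric I G) p y i (Sum.inl ())) z = 0 := by
  refine coordDeriv_eq_zero hJ hz
    (c := Matrix.fromBlocks (1 : Matrix Unit Unit ℝ) 0 0 (1 : Matrix (Fin d) (Fin d) ℝ)
      i (Sum.inl ())) (fun y hy => ?_) k
  rw [coordMatrix_radial hy.2]
  cases i <;> simp

theorem coordDeriv_coordMatrix_inr (hJ : IsOpen J)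
    (hz : z ∈ J ×ˢ (extChartAt I p.2).target) (k : Unit ⊕ Fin d) (A C : Fin d) :
    coordDeriv (𝓘(ℝ, ℝ).prod I) (radialBasis d) k (fun y =>
      coordMatrix (𝓘(ℝ, ℝ).prod I) (radialBasis d) (radialMetric I G) p y (Sum.inr A)
        (Sum.inr C)) z =
    coordDeriv (𝓘(ℝ, ℝ).prod I) (radialBasis d) k (fun y =>
      coordMatrix I (stdBasis d) (G y.1) p.2 y.2 A C) z := by
  refine coordDeriv_congr hJ hz (fun y hy => ?_) k
  rw [coordMatrix_radial hy.2, Matrix.fromBlocks_apply₂₂]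

theorem christoffel_inl_inl (hJ : IsOpen J)
    (hz : z ∈ J ×ˢ (extChartAt I p.2).target) (k : Unit ⊕ Fin d) :
    christoffel (𝓘(ℝ, ℝ).prod I) (radialBasis d) (radialMetric I G) p k (Sum.inl ()) (Sum.inl ())
      z = 0 := by
  simp [christoffel, coordDeriv_coordMatrix_inl_left hJ hz]

theorem christoffel_inl_left (hJ : IsOpen J)
    (hz : z ∈ J ×ˢ (extChartAt I p.2).target)
    (hdet : (coordMatrix I (stdBasis d) (G z.1) p.2 z.2).det ≠ 0) (i : Unit ⊕ Fin d) :
    christoffel (𝓘(ℝ, ℝ).prod I) (radialBasis d) (radialMetric I G) p (Sum.inl ()) (Sum.inl ()) i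
      z = 0 := by
  rw [christoffel, coordMatrix_radial hz.2, fromBlocks_one_inv hdet]
  simp [coordDeriv_coordMatrix_inl_left hJ hz, coordDeriv_coordMatrix_inl_right hJ hz]

theorem christoffel_inr_inl_inr (hJ : IsOpen J)
    (hz : z ∈ J ×ˢ (extChartAt I p.2).target)
    (hdet : (coordMatrix I (stdBasis d) (G z.1) p.2 z.2).det ≠ 0) (A B : Fin d) :
    christoffel (𝓘(ℝ, ℝ).prod I) (radialBasis d) (radialMetric I G) p (Sum.inr B) (Sum.inl ())
      (Sum.inr A) z = chartShape I G p.2 z B A := by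
  rw [christoffel, coordMatrix_radial hz.2, fromBlocks_one_inv hdet]
  simp [coordDeriv_coordMatrix_inl_left hJ hz, coordDeriv_coordMatrix_inr hJ hz, chartShape,
    Matrix.mul_apply]

theorem christoffel_inr_inr_inl (hJ : IsOpen J)
    (hz : z ∈ J ×ˢ (extChartAt I p.2).target)
    (hdet : (coordMatrix I (stdBasis d) (G z.1) p.2 z.2).det ≠ 0) (A B : Fin d) :
    christoffel (𝓘(ℝ, ℝ).prod I) (radialBasis d) (radialMetric I G) p (Sum.inr B) (Sum.inr A)
      (Sum.inl ()) z = chartShape I G p.2 z B A := by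
  rw [christoffel, coordMatrix_radial hz.2, fromBlocks_one_inv hdet]
  simp [coordDeriv_coordMatrix_inl_left hJ hz, coordDeriv_coordMatrix_inl_right hJ hz,
    coordDeriv_coordMatrix_inr hJ hz, chartShape, Matrix.mul_apply]

end Christoffel

theorem meanCurvature_eq_trace_chartShape (hJ : IsOpen J) {r : ℝ} (hr : r ∈ J) (x : N)
    (hdet : (coordMatrix I (stdBasis d) (G r) x (extChartAt I x x)).det ≠ 0) :
    meanCurvature I (radialMetric I G) (r, x) =
      (chartShape I G x (r, extChartAt I x x)).trace := by
  rw [meanCurvature, weingarten, Matrix.trace, Matrix.trace]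
  refine Finset.sum_congr rfl fun A _ => ?_
  exact christoffel_inr_inr_inl (p := (r, x)) (z := (r, extChartAt I x x)) hJ
    ⟨hr, mem_extChartAt_target x⟩ hdet A A

/-- In the coordinate formula the terms with Γᵏ_rr vanish identically, and so does Γʳ_rk. What is
left is -∂ᵣ of Γ^A_{rA} and the quadratic term Γ^B_{rA} Γ^A_{rB}, that is, -∂ᵣ tr S - tr S². -/
theorem ricciRR_eq_chartShape (hJ : IsOpen J) (hG : IsSmoothFamily I J G) {r : ℝ} (hr : r ∈ J)
    (x : N) (hdet : ∀ z ∈ J ×ˢ (extChartAt I x).target,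
      (coordMatrix I (stdBasis d) (G z.1) x z.2).det ≠ 0) :
    ricciRR I (radialMetric I G) (r, x) =
      -coordDeriv (𝓘(ℝ, ℝ).prod I) (radialBasis d) (Sum.inl ())
        (fun z => (chartShape I G x z).trace) (r, extChartAt I x x)
      - (chartShape I G x (r, extChartAt I x x) * chartShape I G x (r, extChartAt I x x)).trace := by
  have hz : (r, extChartAt I x x) ∈ J ×ˢ (extChartAt I x).target := ⟨hr, mem_extChartAt_target x⟩
  have e1 : ∀ k l : Unit ⊕ Fin d, coordDeriv (𝓘(ℝ, ℝ).prod I) (radialBasis d) l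
      (christoffel (𝓘(ℝ, ℝ).prod I) (radialBasis d) (radialMetric I G) (r, x) k (Sum.inl ())
        (Sum.inl ())) (r, extChartAt I x x) = 0 := fun k l =>
    coordDeriv_eq_zero (x₀ := x) hJ hz (c := 0)
      (fun y hy => christoffel_inl_inl (p := (r, x)) hJ hy k) l
  have e2 : coordDeriv (𝓘(ℝ, ℝ).prod I) (radialBasis d) (Sum.inl ())
      (christoffel (𝓘(ℝ, ℝ).prod I) (radialBasis d) (radialMetric I G) (r, x) (Sum.inl ())
        (Sum.inl ()) (Sum.inl ())) (r, extChartAt I x x) = 0 := e1 _ _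
  have e3 : ∀ A, coordDeriv (𝓘(ℝ, ℝ).prod I) (radialBasis d) (Sum.inl ())
      (christoffel (𝓘(ℝ, ℝ).prod I) (radialBasis d) (radialMetric I G) (r, x) (Sum.inr A)
        (Sum.inl ()) (Sum.inr A)) (r, extChartAt I x x) =
      coordDeriv (𝓘(ℝ, ℝ).prod I) (radialBasis d) (Sum.inl ())
        (fun z => chartShape I G x z A A) (r, extChartAt I x x) := fun A =>
    coordDeriv_congr (x₀ := x) hJ hz
      (fun y hy => christoffel_inr_inl_inr (p := (r, x)) hJ hy (hdet y hy) A A) _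
  have e4 : coordDeriv (𝓘(ℝ, ℝ).prod I) (radialBasis d) (Sum.inl ())
        (fun z => (chartShape I G x z).trace) (r, extChartAt I x x) =
      ∑ A, coordDeriv (𝓘(ℝ, ℝ).prod I) (radialBasis d) (Sum.inl ())
        (fun z => chartShape I G x z A A) (r, extChartAt I x x) := by
    have hd : ∀ A, DifferentiableWithinAt ℝ (fun z => chartShape I G x z A A)
        (J ×ˢ (extChartAt I x).target) (r, extChartAt I x x) := fun A =>
      (contDiffOn_chartShape hJ hG hdet A A).differentiableOn (by simp) _ hz
    have h1 := hasDerivAt_radial (x₀ := x) hJ hz (f := fun z => (chartShape I G x z).trace)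
      (DifferentiableWithinAt.fun_sum fun A _ => hd A)
    have h2 := HasDerivAt.fun_sum (u := Finset.univ) fun A _ =>
      hasDerivAt_radial (x₀ := x) hJ hz (hd A)
    exact h1.unique h2
  have hE : extChartAt (𝓘(ℝ, ℝ).prod I) (r, x) (r, x) = (r, extChartAt I x x) := rfl
  have c1 := christoffel_inl_inl (G := G) (p := (r, x)) hJ hz
  have c2 := christoffel_inl_left (p := (r, x)) hJ hz (hdet _ hz)
  have c3 := christoffel_inr_inl_inr (p := (r, x)) hJ hz (hdet _ hz)
  rw [ricciRR, ricci, hE, e4]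
  simp only [Fintype.sum_sum_type, Finset.univ_unique, Finset.sum_singleton, e1, e3, c1, c2, c3,
    PUnit.default_eq_unit]
  simp [Matrix.trace, Matrix.mul_apply, Finset.sum_neg_distrib, sub_eq_add_neg]

end RadialCurvature

/-! ### Matrices of forms and change of basis -/

section FormMatrix

variable {d : ℕ}

/-- The matrix of a bilinear form in the standard basis. -/
def formMatrix (γ : EuclideanSpace ℝ (Fin d) →L[ℝ] EuclideanSpace ℝ (Fin d) →L[ℝ] ℝ) :
    Matrix (Fin d) (Fin d) ℝ :=
  Matrix.of fun i j => γ (stdBasis d i) (stdBasis d j)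

theorem posDef_formMatrix {γ : EuclideanSpace ℝ (Fin d) →L[ℝ] EuclideanSpace ℝ (Fin d) →L[ℝ] ℝ}
    (hsymm : ∀ v w, γ v w = γ w v) (hpos : ∀ v, v ≠ 0 → 0 < γ v v) : (formMatrix γ).PosDef := by
  refine Matrix.PosDef.of_dotProduct_mulVec_pos ?_ fun c hc => ?_
  · ext i j
    simp [formMatrix, hsymm (stdBasis d j)]
  · have hv : (∑ i, c i • stdBasis d i) ≠ 0 := fun h0 =>
      hc (funext fun i => Fintype.linearIndependent_iff.1 (stdBasis d).linearIndependent c h0 i)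
    have := hpos _ hv
    simp only [map_sum, map_smul, sum_apply, smul_apply, smul_eq_mul] at this
    simpa [formMatrix, dotProduct, Matrix.mulVec, Finset.mul_sum, mul_comm, mul_left_comm,
      hsymm] using this

theorem formMatrix_comp (γ : EuclideanSpace ℝ (Fin d) →L[ℝ] EuclideanSpace ℝ (Fin d) →L[ℝ] ℝ)
    (L : EuclideanSpace ℝ (Fin d) →ₗ[ℝ] EuclideanSpace ℝ (Fin d)) {P : Matrix (Fin d) (Fin d) ℝ}
    (hP : P = LinearMap.toMatrix (stdBasis d) (stdBasis d) L) :
    (Matrix.of fun i j => γ (L (stdBasis d i)) (L (stdBasis d j))) =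
      P.transpose * formMatrix γ * P := by
  have hL : ∀ i, L (stdBasis d i) = ∑ k, P k i • stdBasis d k := fun i => by
    rw [hP]
    simp only [LinearMap.toMatrix_apply]
    exact ((stdBasis d).sum_repr _).symm
  ext i j
  simp only [Matrix.of_apply, hL, map_sum, map_smul, sum_apply, smul_apply, smul_eq_mul, Matrix.mul_apply, Matrix.transpose_apply,
    formMatrix, Finset.sum_mul, Finset.mul_sum]
  exact Finset.sum_congr rfl fun k _ => Finset.sum_congr rfl fun l _ => by ring

theorem isUnit_det_toMatrix (L : EuclideanSpace ℝ (Fin d) ≃L[ℝ] EuclideanSpace ℝ (Fin d)) :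
    IsUnit (LinearMap.toMatrix (stdBasis d) (stdBasis d) L.toLinearMap).det := by
  rw [LinearMap.det_toMatrix]
  exact LinearEquiv.isUnit_det' L.toLinearEquiv

theorem hasDerivAt_mul_mul {A : ℝ → Matrix (Fin d) (Fin d) ℝ} {A' : Matrix (Fin d) (Fin d) ℝ}
    {r : ℝ} (hA : ∀ i j, HasDerivAt (fun t => A t i j) (A' i j) r)
    (C D : Matrix (Fin d) (Fin d) ℝ) (i j : Fin d) :
    HasDerivAt (fun t => (C * A t * D) i j) ((C * A' * D) i j) r := by
  simp only [Matrix.mul_apply]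
  exact HasDerivAt.fun_sum fun k _ =>
    (HasDerivAt.fun_sum fun l _ => (hA l k).const_mul _).mul_const _

end FormMatrix

/-! ### The Weingarten map independently of the chart -/

section Shape

variable {d : ℕ} {H : Type*} [TopologicalSpace H]
  {I : ModelWithCorners ℝ (EuclideanSpace ℝ (Fin d)) H}
  {N : Type*} [TopologicalSpace N] [ChartedSpace H N]
  {J : Set ℝ} {x₀ x : N} {r : ℝ}
  {G : ℝ → ∀ x : N, TangentSpace I x →L[ℝ] TangentSpace I x →L[ℝ] ℝ}

/-- The family `G(r)`, `r ∈ J`, consists of inner products. -/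
def IsInnerFamily (I : ModelWithCorners ℝ (EuclideanSpace ℝ (Fin d)) H) (J : Set ℝ)
    (G : ℝ → ∀ x : N, TangentSpace I x →L[ℝ] TangentSpace I x →L[ℝ] ℝ) : Prop :=
  ∀ r ∈ J, ∀ x, (∀ v w, G r x v w = G r x w v) ∧ ∀ v, v ≠ 0 → 0 < G r x v v

theorem IsInnerFamily.posDef (h : IsInnerFamily I J G) (hr : r ∈ J) (x : N) :
    (formMatrix (G r x)).PosDef :=
  posDef_formMatrix (h r hr x).1 (h r hr x).2

theorem continuousOn_of_charts {F : ℝ × N → ℝ} (hJ : IsOpen J)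
    (h : ∀ x₀ : N, ∃ f : ℝ × EuclideanSpace ℝ (Fin d) → ℝ,
      ContinuousOn f (J ×ˢ (extChartAt I x₀).target) ∧
      ∀ r ∈ J, ∀ x ∈ (extChartAt I x₀).source, F (r, x) = f (r, extChartAt I x₀ x)) :
    ContinuousOn F (J ×ˢ univ) := by
  rintro ⟨r, x⟩ hp
  obtain ⟨f, hf, hFf⟩ := h x
  have h1 : ContinuousOn (fun p : ℝ × N => (p.1, extChartAt I x p.2))
      (J ×ˢ (extChartAt I x).source) :=
    continuousOn_fst.prodMk ((continuousOn_extChartAt x).comp continuousOn_snd fun p hp => hp.2)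
  have h2 : ContinuousOn F (J ×ˢ (extChartAt I x).source) :=
    (hf.comp h1 fun p hp => ⟨hp.1, (extChartAt I x).map_source hp.2⟩).congr
      fun p hp => hFf p.1 hp.1 p.2 hp.2
  have h3 : J ×ˢ (extChartAt I x).source ∈ 𝓝 (r, x) :=
    prod_mem_nhds (hJ.mem_nhds hp.1) (extChartAt_source_mem_nhds x)
  exact (h2.continuousAt h3).continuousWithinAt

variable [IsManifold I ∞ N]

/-- P is the Jacobian of the inverse chart at x. It is chosen before γ, so one P works for all G(r)
at once and can be treated as a constant when differentiating in r. -/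
theorem exists_coordMatrix_eq_conj (hx : x ∈ (extChartAt I x₀).source) :
    ∃ P : Matrix (Fin d) (Fin d) ℝ, IsUnit P.det ∧
      ∀ γ : ∀ x : N, TangentSpace I x →L[ℝ] TangentSpace I x →L[ℝ] ℝ,
      coordMatrix I (stdBasis d) γ x₀ (extChartAt I x₀ x) =
        P.transpose * formMatrix (γ x) * P := by
  obtain ⟨L, hL⟩ := exists_equiv_coordVec_eq (b := stdBasis d) hx
  refine ⟨_, isUnit_det_toMatrix L, fun γ => ?_⟩
  -- The coordinate matrix evaluates γ at the inverse chart of the chart of x, which equals x only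
  -- propositionally.
  have hγ : ∀ y, y = x → ∀ v w : EuclideanSpace ℝ (Fin d),
      (γ y : EuclideanSpace ℝ (Fin d) →L[ℝ] EuclideanSpace ℝ (Fin d) →L[ℝ] ℝ) v w =
      (γ x : EuclideanSpace ℝ (Fin d) →L[ℝ] EuclideanSpace ℝ (Fin d) →L[ℝ] ℝ) v w := by
    rintro y rfl v w; rfl
  refine Eq.trans ?_ (formMatrix_comp (γ x) L.toLinearMap rfl)
  ext i j
  simp only [coordMatrix, Matrix.of_apply]
  refine (hγ _ ((extChartAt I x₀).left_inv hx) _ _).trans ?_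
  rw [hL, hL]
  rfl

/-- The matrix of the derivative `∂ᵣ G(r)` at `x`. -/
def formDeriv (I : ModelWithCorners ℝ (EuclideanSpace ℝ (Fin d)) H)
    (G : ℝ → ∀ x : N, TangentSpace I x →L[ℝ] TangentSpace I x →L[ℝ] ℝ) (r : ℝ) (x : N) :
    Matrix (Fin d) (Fin d) ℝ :=
  Matrix.of fun i j => deriv (fun t => formMatrix (G t x) i j) r

/-- The matrix `½ G^{BC} ∂ᵣ G_{AC}` of the Weingarten map at `(r, x)`. -/
def shape (I : ModelWithCorners ℝ (EuclideanSpace ℝ (Fin d)) H)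
    (G : ℝ → ∀ x : N, TangentSpace I x →L[ℝ] TangentSpace I x →L[ℝ] ℝ) (r : ℝ) (x : N) :
    Matrix (Fin d) (Fin d) ℝ :=
  (1 / 2 : ℝ) • ((formMatrix (G r x))⁻¹ * (formDeriv I G r x).transpose)

/-- With P constant in r, both G and ∂ᵣG change by X ↦ Pᵀ X P, hence G⁻¹ ∂ᵣG by conjugation. Undoing
the congruence also gives differentiability of the standard components, which `deriv` in `formDeriv`
does not provide by itself. -/
theorem exists_chartShape_eq_conj (hJ : IsOpen J) (hG : IsSmoothFamily I J G) (hr : r ∈ J)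
    (hx : x ∈ (extChartAt I x₀).source) :
    (∀ i j, HasDerivAt (fun t => formMatrix (G t x) i j) (formDeriv I G r x i j) r) ∧
    ∃ P : Matrix (Fin d) (Fin d) ℝ, IsUnit P.det ∧
      chartShape I G x₀ (r, extChartAt I x₀ x) = P⁻¹ * shape I G r x * P := by
  obtain ⟨P, hP, hA⟩ := exists_coordMatrix_eq_conj (I := I) hx
  have hz : (r, extChartAt I x₀ x) ∈ J ×ˢ (extChartAt I x₀).target :=
    ⟨hr, (extChartAt I x₀).map_source hx⟩
  set A' : Matrix (Fin d) (Fin d) ℝ := Matrix.of fun A C =>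
    coordDeriv (𝓘(ℝ, ℝ).prod I) (radialBasis d) (Sum.inl ())
      (fun y => coordMatrix I (stdBasis d) (G y.1) x₀ y.2 A C) (r, extChartAt I x₀ x) with hA'
  have hd : ∀ i j, HasDerivAt (fun t => (P.transpose * formMatrix (G t x) * P) i j) (A' i j) r := by
    intro i j
    have := hasDerivAt_radial hJ hz ((hG x₀ i j).differentiableOn (by simp) _ hz)
    simp only [hA] at this
    exact this
  have hP' : IsUnit P.transpose.det := by rwa [Matrix.det_transpose]
  have hcancel : ∀ X, P.transpose⁻¹ * (P.transpose * X * P) * P⁻¹ = X := fun X => by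
    rw [Matrix.mul_assoc P.transpose, Matrix.nonsing_inv_mul_cancel_left _ _ hP',
      Matrix.mul_nonsing_inv_cancel_right _ _ hP]
  have hd2 := hasDerivAt_mul_mul hd P.transpose⁻¹ P⁻¹
  simp only [hcancel] at hd2
  have hform : formDeriv I G r x = P.transpose⁻¹ * A' * P⁻¹ := by
    ext i j; exact (hd2 i j).deriv
  refine ⟨fun i j => hform ▸ hd2 i j, P, hP, ?_⟩
  have hA'2 : A'.transpose = P.transpose * (formDeriv I G r x).transpose * P := by
    rw [hform]
    simp only [Matrix.transpose_mul, Matrix.transpose_nonsing_inv, Matrix.transpose_transpose,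
      Matrix.mul_assoc]
    rw [Matrix.mul_nonsing_inv_cancel_left _ _ hP', Matrix.nonsing_inv_mul _ hP, Matrix.mul_one]
  rw [chartShape, ← hA', hA, hA'2, conj_inv_mul_conj hP, shape, Matrix.mul_smul, Matrix.smul_mul]

theorem trace_chartShape (hJ : IsOpen J) (hG : IsSmoothFamily I J G) (hr : r ∈ J)
    (hx : x ∈ (extChartAt I x₀).source) :
    (chartShape I G x₀ (r, extChartAt I x₀ x)).trace = (shape I G r x).trace := by
  obtain ⟨-, P, hP, h⟩ := exists_chartShape_eq_conj hJ hG hr hx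
  rw [h, trace_conj hP]

theorem trace_chartShape_sq (hJ : IsOpen J) (hG : IsSmoothFamily I J G) (hr : r ∈ J)
    (hx : x ∈ (extChartAt I x₀).source) :
    (chartShape I G x₀ (r, extChartAt I x₀ x) * chartShape I G x₀ (r, extChartAt I x₀ x)).trace =
      (shape I G r x * shape I G r x).trace := by
  obtain ⟨-, P, hP, h⟩ := exists_chartShape_eq_conj hJ hG hr hx
  rw [h, conj_mul_conj hP, trace_conj hP]

theorem IsInnerFamily.det_ne_zero (h : IsInnerFamily I J G)
    {z : ℝ × EuclideanSpace ℝ (Fin d)} (hz : z ∈ J ×ˢ (extChartAt I x₀).target) :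
    (coordMatrix I (stdBasis d) (G z.1) x₀ z.2).det ≠ 0 := by
  obtain ⟨P, hP, hA⟩ := exists_coordMatrix_eq_conj (I := I) ((extChartAt I x₀).map_target hz.2)
  rw [(extChartAt I x₀).right_inv hz.2] at hA
  rw [hA, Matrix.det_mul, Matrix.det_mul, Matrix.det_transpose]
  exact mul_ne_zero (mul_ne_zero hP.ne_zero (h.posDef hz.1 _).det_pos.ne') hP.ne_zero

theorem meanCurvature_eq_trace_shape (hJ : IsOpen J) (hG : IsSmoothFamily I J G)
    (hI : IsInnerFamily I J G) (hr : r ∈ J) (x : N) :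
    meanCurvature I (radialMetric I G) (r, x) = (shape I G r x).trace := by
  rw [meanCurvature_eq_trace_chartShape hJ hr x
      (hI.det_ne_zero (z := (r, extChartAt I x x)) ⟨hr, mem_extChartAt_target x⟩),
    trace_chartShape hJ hG hr (mem_extChartAt_source x)]

theorem contDiffOn_trace_chartShape (hJ : IsOpen J) (hG : IsSmoothFamily I J G)
    (hI : IsInnerFamily I J G) (x₀ : N) :
    ContDiffOn ℝ ∞ (fun z => (chartShape I G x₀ z).trace) (J ×ˢ (extChartAt I x₀).target) :=
  ContDiffOn.sum fun A _ => contDiffOn_chartShape hJ hG (fun _ hz => hI.det_ne_zero hz) A A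

theorem hasDerivAt_meanCurvature (hJ : IsOpen J) (hG : IsSmoothFamily I J G)
    (hI : IsInnerFamily I J G) (hr : r ∈ J) (hx : x ∈ (extChartAt I x₀).source) :
    HasDerivAt (fun t => meanCurvature I (radialMetric I G) (t, x))
      (coordDeriv (𝓘(ℝ, ℝ).prod I) (radialBasis d) (Sum.inl ())
        (fun z => (chartShape I G x₀ z).trace) (r, extChartAt I x₀ x)) r := by
  have hz : (r, extChartAt I x₀ x) ∈ J ×ˢ (extChartAt I x₀).target :=
    ⟨hr, (extChartAt I x₀).map_source hx⟩
  have h1 := hasDerivAt_radial hJ hz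
    ((contDiffOn_trace_chartShape hJ hG hI x₀).differentiableOn (by simp) _ hz)
  refine h1.congr_of_eventuallyEq ?_
  filter_upwards [hJ.mem_nhds hr] with t ht
  rw [meanCurvature_eq_trace_shape hJ hG hI ht, trace_chartShape hJ hG ht hx]

theorem ricciRR_eq (hJ : IsOpen J) (hG : IsSmoothFamily I J G)
    (hI : IsInnerFamily I J G) (hr : r ∈ J) (x : N) :
    ricciRR I (radialMetric I G) (r, x) =
      -deriv (fun t => meanCurvature I (radialMetric I G) (t, x)) r
      - (shape I G r x * shape I G r x).trace := by
  rw [ricciRR_eq_chartShape hJ hG hr x (fun _ hz => hI.det_ne_zero hz),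
    (hasDerivAt_meanCurvature hJ hG hI hr (mem_extChartAt_source x)).deriv,
    trace_chartShape_sq hJ hG hr (mem_extChartAt_source x)]

/-- The definition uses a different chart at each x, so continuity in x is not visible from it. Near
x₀ the trace is invariant under the change of basis and equals a smooth function in the single chart
around x₀. -/
theorem continuousOn_meanCurvature (hJ : IsOpen J) (hG : IsSmoothFamily I J G)
    (hI : IsInnerFamily I J G) :
    ContinuousOn (meanCurvature I (radialMetric I G)) (J ×ˢ univ) :=
  continuousOn_of_charts (I := I) hJ fun x₀ =>
    ⟨_, (contDiffOn_trace_chartShape hJ hG hI x₀).continuousOn, fun r hr x hx => by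
      rw [meanCurvature_eq_trace_shape hJ hG hI hr, trace_chartShape hJ hG hr hx]⟩

theorem continuousOn_deriv_meanCurvature (hJ : IsOpen J) (hG : IsSmoothFamily I J G)
    (hI : IsInnerFamily I J G) :
    ContinuousOn (fun p : ℝ × N => deriv (fun t => meanCurvature I (radialMetric I G) (t, p.2)) p.1)
      (J ×ˢ univ) :=
  continuousOn_of_charts (I := I) hJ fun x₀ =>
    ⟨_, (contDiffOn_coordDeriv hJ (contDiffOn_trace_chartShape hJ hG hI x₀)
      (Sum.inl ())).continuousOn, fun _ hr _ hx =>
        (hasDerivAt_meanCurvature hJ hG hI hr hx).deriv⟩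

theorem continuousOn_trace_shape_sq (hJ : IsOpen J) (hG : IsSmoothFamily I J G)
    (hI : IsInnerFamily I J G) :
    ContinuousOn (fun p : ℝ × N => (shape I G p.1 p.2 * shape I G p.1 p.2).trace) (J ×ˢ univ) := by
  refine continuousOn_of_charts (I := I) hJ fun x₀ => ⟨fun z =>
    (chartShape I G x₀ z * chartShape I G x₀ z).trace, ?_, fun r hr x hx =>
      (trace_chartShape_sq hJ hG hr hx).symm⟩
  have h := contDiffOn_chartShape hJ hG (fun _ hz => hI.det_ne_zero (x₀ := x₀) hz)
  simp only [Matrix.trace, Matrix.diag_apply, Matrix.mul_apply]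
  exact continuousOn_finsetSum _ fun i _ => continuousOn_finsetSum _ fun j _ =>
    (h i j).continuousOn.mul (h j i).continuousOn

end Shape

/-! ### The Riemannian measure: finiteness and positivity -/

section RiemannianMeasure

variable {d : ℕ} {H : Type*} [TopologicalSpace H]
  {I : ModelWithCorners ℝ (EuclideanSpace ℝ (Fin d)) H}
  {N : Type*} [TopologicalSpace N] [ChartedSpace H N]

/-- The differential of the inverse of the chart around `p`, at the point of coordinates `z`. -/
def symmDeriv (I : ModelWithCorners ℝ (EuclideanSpace ℝ (Fin d)) H) (p : N)
    (z : EuclideanSpace ℝ (Fin d)) : EuclideanSpace ℝ (Fin d) →L[ℝ] EuclideanSpace ℝ (Fin d) :=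
  mfderivWithin 𝓘(ℝ, EuclideanSpace ℝ (Fin d)) I (extChartAt I p).symm (range I) z

/-- The volume density `√(det g_{AB})` in the chart around `p`. -/
def chartDensity (γ : ∀ x : N, TangentSpace I x →L[ℝ] TangentSpace I x →L[ℝ] ℝ) (p : N)
    (z : EuclideanSpace ℝ (Fin d)) : ℝ :=
  Real.sqrt (coordMatrix I (stdBasis d) γ p z).det

theorem chartDensity_eq (γ : ∀ x : N, TangentSpace I x →L[ℝ] TangentSpace I x →L[ℝ] ℝ) (p : N)
    (z : EuclideanSpace ℝ (Fin d)) :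
    chartDensity γ p z =
      |(symmDeriv I p z).det| * Real.sqrt (formMatrix (γ ((extChartAt I p).symm z))).det := by
  have h : coordMatrix I (stdBasis d) γ p z = _ :=
    formMatrix_comp (γ ((extChartAt I p).symm z)) (symmDeriv I p z).toLinearMap rfl
  rw [chartDensity, h, Matrix.det_mul, Matrix.det_mul, Matrix.det_transpose, LinearMap.det_toMatrix,
    mul_right_comm, ← sq, Real.sqrt_mul (sq_nonneg _), Real.sqrt_sq_eq_abs]

theorem measurableSet_extChartAt_target (p : N) : MeasurableSet (extChartAt I p).target := by
  rw [extChartAt_target]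
  exact ((chartAt H p).open_target.preimage I.continuous_symm).measurableSet.inter
    I.isClosed_range.measurableSet

section Overlap

variable [IsManifold I ∞ N] {p q : N} {z : EuclideanSpace ℝ (Fin d)}

theorem differentiableWithinAt_coordChange (hz : z ∈ (extChartAt I p).target)
    (hq : (extChartAt I p).symm z ∈ (extChartAt I q).source) :
    DifferentiableWithinAt ℝ (extChartAt I q ∘ (extChartAt I p).symm) (range I) z :=
  (contDiffWithinAt_ext_coord_change (n := ∞) q p
    ⟨hz, hq⟩).differentiableWithinAt (by simp)

theorem symmDeriv_eq_comp (hz : z ∈ (extChartAt I p).target)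
    (hq : (extChartAt I p).symm z ∈ (extChartAt I q).source) :
    symmDeriv I p z = (symmDeriv I q (extChartAt I q ((extChartAt I p).symm z))).comp
      (fderivWithin ℝ (extChartAt I q ∘ (extChartAt I p).symm) (range I) z) := by
  have : IsManifold I 1 N := .of_le (n := ∞) (by simp)
  have hd := (differentiableWithinAt_coordChange hz hq).hasFDerivWithinAt.hasMFDerivWithinAt
  have hq' := (extChartAt I q).map_source hq
  have hs := (mdifferentiableWithinAt_extChartAt_symm (I := I) (x := q) hq').hasMFDerivWithinAt
  have hc := HasMFDerivWithinAt.comp (s := range I) z hs hd (fun y _ => by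
    simp only [mem_preimage, Function.comp, mfld_simps])
  have heq : (extChartAt I p).symm =ᶠ[𝓝[range I] z]
      (extChartAt I q).symm ∘ (extChartAt I q ∘ (extChartAt I p).symm) := by
    have hcont := (continuousAt_extChartAt_symm'' (I := I) hz).continuousWithinAt (s := range I)
    filter_upwards [hcont ((isOpen_extChartAt_source q).mem_nhds hq)] with y hy
    exact ((extChartAt I q).left_inv hy).symm
  have hc' := hc.congr_of_eventuallyEq heq ((extChartAt I q).left_inv hq).symm
  exact hc'.mfderivWithin (I.uniqueMDiffOn z (extChartAt_target_subset_range p hz))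

/-- By the chain rule for the inverse charts, √det g changes by the absolute Jacobian of the
transition map, which is the factor in the change of variables formula. -/
theorem chartDensity_eq_mul (γ : ∀ x : N, TangentSpace I x →L[ℝ] TangentSpace I x →L[ℝ] ℝ)
    (hz : z ∈ (extChartAt I p).target)
    (hq : (extChartAt I p).symm z ∈ (extChartAt I q).source) :
    chartDensity γ p z =
      |(fderivWithin ℝ (extChartAt I q ∘ (extChartAt I p).symm) (range I) z).det| *
        chartDensity γ q (extChartAt I q ((extChartAt I p).symm z)) := by
  rw [chartDensity_eq, chartDensity_eq, symmDeriv_eq_comp hz hq, (extChartAt I q).left_inv hq,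
    ContinuousLinearMap.det, ContinuousLinearMap.toLinearMap_comp, LinearMap.det_comp, abs_mul]
  simp only [ContinuousLinearMap.det]
  ring

theorem continuousOn_chartDensity (γ : Metric I N) (p : N) :
    ContinuousOn (chartDensity γ.inner p) (extChartAt I p).target := by
  have h := contDiffOn_coordMatrix (b := stdBasis d) γ.contMDiff.contMDiffOn (s := univ) p
  simp only [preimage_univ, inter_univ] at h
  exact (contDiffOn_matrix_det h).continuousOn.sqrt

theorem chartDensity_pos (γ : Metric I N) {p : N} {z : EuclideanSpace ℝ (Fin d)}
    (hz : z ∈ (extChartAt I p).target) : 0 < chartDensity γ.inner p z := by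
  obtain ⟨P, hP, hA⟩ := exists_coordMatrix_eq_conj (I := I) ((extChartAt I p).map_target hz)
  rw [(extChartAt I p).right_inv hz] at hA
  refine Real.sqrt_pos.2 ?_
  rw [hA, Matrix.det_mul, Matrix.det_mul, Matrix.det_transpose, mul_right_comm]
  exact mul_pos (mul_self_pos.2 hP.ne_zero)
    (posDef_formMatrix (γ.symm _) (γ.pos _)).det_pos

end Overlap

variable [MeasurableSpace N] [BorelSpace N]

theorem measurableSet_target_inter_preimage (p : N) {s : Set N} (hs : MeasurableSet s) :
    MeasurableSet ((extChartAt I p).target ∩ (extChartAt I p).symm ⁻¹' s) := by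
  have h := (continuousOn_iff_continuous_domRestrict.1
    (continuousOn_extChartAt_symm (I := I) p)).measurable hs
  have h2 := (measurableSet_extChartAt_target (I := I) p).subtype_image h
  rwa [domRestrict_eq, preimage_comp, Subtype.image_preimage_coe] at h2

theorem chartVolume_apply (γ : ∀ x : N, TangentSpace I x →L[ℝ] TangentSpace I x →L[ℝ] ℝ) (p : N)
    {s : Set N} (hs : MeasurableSet s) :
    chartVolume I γ p s = ∫⁻ z in (extChartAt I p).target ∩ (extChartAt I p).symm ⁻¹' s,
      ENNReal.ofReal (chartDensity γ p z) := by
  have ht := measurableSet_extChartAt_target (I := I) p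
  have h : AEMeasurable (extChartAt I p).symm (volume.restrict (extChartAt I p).target) :=
    (continuousOn_extChartAt_symm (I := I) p).aemeasurable ht
  rw [chartVolume, Measure.map_apply_of_aemeasurable
      (h.mono_ac (withDensity_absolutelyContinuous _ _)) hs, withDensity_apply',
    Measure.restrict_restrict' ht, inter_comm]
  rfl

theorem chartVolume_inter_source (γ : ∀ x : N, TangentSpace I x →L[ℝ] TangentSpace I x →L[ℝ] ℝ)
    (p : N) {s : Set N} (hs : MeasurableSet s) :
    chartVolume I γ p s = chartVolume I γ p (s ∩ (extChartAt I p).source) := by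
  rw [chartVolume_apply γ p hs,
    chartVolume_apply γ p (hs.inter (isOpen_extChartAt_source p).measurableSet)]
  congr 2
  ext z
  simp only [mem_inter_iff, mem_preimage]
  exact ⟨fun h => ⟨h.1, h.2, (extChartAt I p).map_target h.1⟩, fun h => ⟨h.1, h.2.1⟩⟩

variable [IsManifold I ∞ N]

/-- The chart measures agree on overlaps. -/
theorem chartVolume_eq_of_subset
    (γ : ∀ x : N, TangentSpace I x →L[ℝ] TangentSpace I x →L[ℝ] ℝ) {p q : N}
    {s : Set N} (hs : MeasurableSet s) (hp : s ⊆ (extChartAt I p).source)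
    (hq : s ⊆ (extChartAt I q).source) : chartVolume I γ p s = chartVolume I γ q s := by
  rw [chartVolume_apply γ p hs, chartVolume_apply γ q hs]
  set S := (extChartAt I p).target ∩ (extChartAt I p).symm ⁻¹' s with hS
  set T := extChartAt I q ∘ (extChartAt I p).symm
  have himg : T '' S = (extChartAt I q).target ∩ (extChartAt I q).symm ⁻¹' s := by
    ext w
    constructor
    · rintro ⟨z, hz, rfl⟩
      refine ⟨(extChartAt I q).map_source (hq hz.2), ?_⟩
      simp only [mem_preimage, T, Function.comp, (extChartAt I q).left_inv (hq hz.2)]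
      exact hz.2
    · rintro ⟨hw, hws⟩
      refine ⟨extChartAt I p ((extChartAt I q).symm w), ⟨(extChartAt I p).map_source (hp hws), ?_⟩,
        ?_⟩
      · simp only [mem_preimage, (extChartAt I p).left_inv (hp hws)]; exact hws
      · simp only [T, Function.comp, (extChartAt I p).left_inv (hp hws),
          (extChartAt I q).right_inv hw]
  have hinj : InjOn T S := by
    intro z hz w hw h
    have h1 := (extChartAt I q).injOn (hq hz.2) (hq hw.2) h
    exact (extChartAt I p).symm.injOn hz.1 hw.1 h1
  have hder : ∀ z ∈ S, HasFDerivWithinAt T (fderivWithin ℝ T (range I) z) S z := fun z hz =>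
    (differentiableWithinAt_coordChange hz.1 (hq hz.2)).hasFDerivWithinAt.mono
      (inter_subset_left.trans (extChartAt_target_subset_range p))
  have hSm := measurableSet_target_inter_preimage (I := I) p hs
  rw [← himg, lintegral_image_eq_lintegral_abs_det_fderiv_mul volume hSm hder hinj]
  refine setLIntegral_congr_fun hSm fun z hz => ?_
  rw [chartDensity_eq_mul γ hz.1 (hq hz.2), ENNReal.ofReal_mul (abs_nonneg _)]
  rfl

theorem chartVolume_lt_top (γ : Metric I N) (p : N) {K : Set N} (hK : IsCompact K)
    (hKm : MeasurableSet K) (hKp : K ⊆ (extChartAt I p).source) :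
    chartVolume I γ.inner p K < ⊤ := by
  rw [chartVolume_apply _ _ hKm]
  have himg : (extChartAt I p).target ∩ (extChartAt I p).symm ⁻¹' K = extChartAt I p '' K := by
    ext w
    constructor
    · exact fun hw => ⟨_, hw.2, (extChartAt I p).right_inv hw.1⟩
    · rintro ⟨x, hx, rfl⟩
      refine ⟨(extChartAt I p).map_source (hKp hx), ?_⟩
      simp only [mem_preimage, (extChartAt I p).left_inv (hKp hx)]; exact hx
  have hc : IsCompact (extChartAt I p '' K) :=
    hK.image_of_continuousOn ((continuousOn_extChartAt p).mono hKp)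
  have hi : IntegrableOn (chartDensity γ.inner p) (extChartAt I p '' K) :=
    ((continuousOn_chartDensity γ p).mono (by rw [← himg]; exact inter_subset_left)
      ).integrableOn_compact hc
  rw [himg]
  exact hi.lintegral_lt_top

/-- Finitely many compact sets, each inside one chart, cover N. The sum of the chart measures
restricted to them is finite, and it dominates every chart measure because chart measures agree on
overlaps; hence it dominates the supremum. -/
theorem isFiniteMeasure_riemannianMeasure [CompactSpace N] [T2Space N] (γ : Metric I N) :
    IsFiniteMeasure (riemannianMeasure I γ.inner) := by
  have hK : ∀ x : N, ∃ K ∈ 𝓝 x, K ⊆ (extChartAt I x).source ∧ IsCompact K := fun x => by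
    obtain ⟨K, hK, hKs, hKc⟩ := local_compact_nhds (extChartAt_source_mem_nhds (I := I) x)
    exact ⟨K, hK, hKs, hKc⟩
  choose K hKn hKs hKc using hK
  have hKm : ∀ x, MeasurableSet (K x) := fun x => (hKc x).measurableSet
  obtain ⟨t, -, ht⟩ := isCompact_univ.elim_nhds_subcover K fun x _ => hKn x
  set ν : Measure N := ∑ x ∈ t, (chartVolume I γ.inner x).restrict (K x)
  have hν : IsFiniteMeasure ν := by
    refine ⟨?_⟩
    simp only [ν, Measure.finsetSum_apply, Measure.restrict_apply_univ]
    exact ENNReal.sum_lt_top.2 fun x _ => chartVolume_lt_top γ x (hKc x) (hKm x) (hKs x)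
  refine isFiniteMeasure_of_le ν (iSup_le fun p => Measure.le_iff.2 fun s hs => ?_)
  have hsp := hs.inter (isOpen_extChartAt_source (I := I) p).measurableSet
  calc chartVolume I γ.inner p s
      = chartVolume I γ.inner p (s ∩ (extChartAt I p).source) := chartVolume_inter_source _ p hs
    _ ≤ chartVolume I γ.inner p (⋃ x ∈ t, s ∩ (extChartAt I p).source ∩ K x) := by
        refine measure_mono fun y hy => ?_
        obtain ⟨x, hx, hyx⟩ := mem_iUnion₂.1 (ht (mem_univ y))
        exact mem_iUnion₂.2 ⟨x, hx, hy, hyx⟩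
    _ ≤ ∑ x ∈ t, chartVolume I γ.inner p (s ∩ (extChartAt I p).source ∩ K x) :=
        measure_biUnion_finset_le _ _
    _ ≤ ∑ x ∈ t, (chartVolume I γ.inner x).restrict (K x) s := by
        refine Finset.sum_le_sum fun x _ => ?_
        rw [chartVolume_eq_of_subset γ.inner (q := x) (hsp.inter (hKm x))
          (inter_subset_left.trans inter_subset_right) (inter_subset_right.trans (hKs x)),
          Measure.restrict_apply hs]
        exact measure_mono (inter_subset_inter_left _ inter_subset_left)
    _ = ν s := by simp [ν]

theorem isOpenPosMeasure_riemannianMeasure (γ : Metric I N) :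
    (riemannianMeasure I γ.inner).IsOpenPosMeasure := by
  refine ⟨fun U hU ⟨x, hx⟩ h0 => ?_⟩
  have h1 : chartVolume I γ.inner x U = 0 :=
    le_antisymm (h0 ▸ le_iSup (fun p => chartVolume I γ.inner p) x U) zero_le
  rw [chartVolume_apply _ _ hU.measurableSet] at h1
  have hn : (extChartAt I x).target ∩ (extChartAt I x).symm ⁻¹' U ∈ 𝓝[range I] extChartAt I x x := by
    refine inter_mem (extChartAt_target_mem_nhdsWithin x) ?_
    have := (continuousAt_extChartAt_symm (I := I) x).continuousWithinAt (s := range I)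
    exact this (by rw [extChartAt_to_inv]; exact hU.mem_nhds hx)
  obtain ⟨O, hO, hxO, hOs⟩ := mem_nhdsWithin.1 hn
  -- When x is a boundary point its coordinates need not be interior to the range of the model. The
  -- interior is dense in the range, so a nonempty open piece still lies in the image of U.
  have hcl : extChartAt I x x ∈ closure (interior (range I)) :=
    I.range_subset_closure_interior (extChartAt_target_subset_range x (mem_extChartAt_target x))
  have hne : (O ∩ interior (range I)).Nonempty := mem_closure_iff.1 hcl O hO hxO
  have hsub : O ∩ interior (range I) ⊆ (extChartAt I x).target ∩ (extChartAt I x).symm ⁻¹' U :=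
    (inter_subset_inter_right _ interior_subset).trans hOs
  have hopen : IsOpen (O ∩ interior (range I)) := hO.inter isOpen_interior
  have h2 : ∫⁻ z in O ∩ interior (range I), ENNReal.ofReal (chartDensity γ.inner x z) = 0 :=
    le_antisymm (h1 ▸ lintegral_mono_set hsub) zero_le
  have hc := (continuousOn_chartDensity γ x).mono (hsub.trans inter_subset_left)
  rw [lintegral_eq_zero_iff' (hc.aemeasurable hopen.measurableSet).ennreal_ofReal] at h2
  have h3 : ∀ᵐ z ∂(volume.restrict (O ∩ interior (range I))), False := by
    filter_upwards [h2, ae_restrict_mem hopen.measurableSet] with z hz hzO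
    have := ENNReal.ofReal_pos.2 (chartDensity_pos γ (hsub hzO).1)
    exact this.ne' hz
  have h4 : (volume.restrict (O ∩ interior (range I))) = 0 := by
    simpa using h3
  exact hopen.measure_ne_zero volume hne (by simpa using h4)

end RiemannianMeasure

/-! ### The derivative of the radial mass -/

section MassIdentity

variable {d : ℕ} {H : Type*} [TopologicalSpace H]
  {I : ModelWithCorners ℝ (EuclideanSpace ℝ (Fin d)) H}
  {N : Type*} [TopologicalSpace N] [ChartedSpace H N]
  {J : Set ℝ} {r : ℝ} {h : ℝ → ℝ}
  {G : ℝ → ∀ x : N, TangentSpace I x →L[ℝ] TangentSpace I x →L[ℝ] ℝ}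

theorem isSymm_formMatrix
    {γ : EuclideanSpace ℝ (Fin d) →L[ℝ] EuclideanSpace ℝ (Fin d) →L[ℝ] ℝ}
    (hs : ∀ v w, γ v w = γ w v) : (formMatrix γ).IsSymm := by
  ext i j; exact hs _ _

theorem formDeriv_isSymm (hJ : IsOpen J) (hI : IsInnerFamily I J G) (hr : r ∈ J) (x : N) :
    (formDeriv I G r x).IsSymm := by
  ext i j
  refine Filter.EventuallyEq.deriv_eq ?_
  filter_upwards [hJ.mem_nhds hr] with t ht
  exact (hI t ht x).1 _ _

theorem inv_smul_of_ne_zero {A : Matrix (Fin d) (Fin d) ℝ} {c : ℝ} (hc : c ≠ 0)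
    (hA : IsUnit A.det) : (c • A)⁻¹ = c⁻¹ • A⁻¹ := by
  refine Matrix.inv_eq_right_inv ?_
  rw [Matrix.smul_mul, Matrix.mul_smul, smul_smul, mul_inv_cancel₀ hc, one_smul,
    Matrix.mul_nonsing_inv _ hA]

/-- The squared norm `|S - (h' / h)|²`, weighted by `h²`. -/
def shapeDefect (I : ModelWithCorners ℝ (EuclideanSpace ℝ (Fin d)) H)
    (G : ℝ → ∀ x : N, TangentSpace I x →L[ℝ] TangentSpace I x →L[ℝ] ℝ) (h : ℝ → ℝ) (p : ℝ × N) :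
    ℝ :=
  h p.1 ^ 2 * ((shape I G p.1 p.2 - (deriv h p.1 / h p.1) • 1) *
    (shape I G p.1 p.2 - (deriv h p.1 / h p.1) • 1)).trace

theorem trace_sub_smul_one_sq (S : Matrix (Fin d) (Fin d) ℝ) (k : ℝ) :
    ((S - k • 1) * (S - k • 1)).trace = (S * S).trace - 2 * k * S.trace + d * k ^ 2 := by
  have : (S - k • 1) * (S - k • 1) = S * S - (2 * k) • S + (k ^ 2) • 1 := by
    rw [Matrix.sub_mul, Matrix.mul_sub, Matrix.mul_sub]
    simp only [Matrix.mul_smul, Matrix.smul_mul, Matrix.mul_one, Matrix.one_mul, smul_smul]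
    module
  rw [this, Matrix.trace_add, Matrix.trace_sub, Matrix.trace_smul, Matrix.trace_smul,
    Matrix.trace_one, Fintype.card_fin]
  simp only [smul_eq_mul]
  ring

theorem shape_sub_smul_one (hI : IsInnerFamily I J G) (hr : r ∈ J) (x : N) (k : ℝ) :
    shape I G r x - k • 1 = (formMatrix (G r x))⁻¹ *
      ((1 / 2 : ℝ) • (formDeriv I G r x).transpose - k • formMatrix (G r x)) := by
  rw [shape, Matrix.mul_sub, Matrix.mul_smul, Matrix.mul_smul, Matrix.nonsing_inv_mul _
    (isUnit_iff_ne_zero.2 (hI.posDef hr x).det_pos.ne')]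

/-- With K = ½ ∂ᵣG - kG symmetric, the trace is that of G⁻¹ K G⁻¹ Kᵀ, the squared norm of K for the
inner product G(r). Without the symmetry of K the trace of a square could be negative. -/
theorem trace_shape_sub_sq (hJ : IsOpen J) (hI : IsInnerFamily I J G) (hr : r ∈ J) (x : N) (k : ℝ) :
    0 ≤ ((shape I G r x - k • 1) * (shape I G r x - k • 1)).trace ∧
    (((shape I G r x - k • 1) * (shape I G r x - k • 1)).trace = 0 →
      formDeriv I G r x = (2 * k) • formMatrix (G r x)) := by
  have hA := hI.posDef hr x
  have hs1 : (formDeriv I G r x).transpose = formDeriv I G r x := formDeriv_isSymm hJ hI hr x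
  have hs2 : (formMatrix (G r x)).transpose = formMatrix (G r x) :=
    isSymm_formMatrix (hI r hr x).1
  set K := (1 / 2 : ℝ) • (formDeriv I G r x).transpose - k • formMatrix (G r x) with hK
  have hKs : K.transpose = K := by
    rw [hK, Matrix.transpose_sub, Matrix.transpose_smul, Matrix.transpose_smul, hs1, hs1, hs2]
  have htr : ((shape I G r x - k • 1) * (shape I G r x - k • 1)).trace =
      ((formMatrix (G r x))⁻¹ * K * ((formMatrix (G r x))⁻¹ * K.transpose)).trace := by
    rw [shape_sub_smul_one hI hr, hKs]
  rw [htr]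
  refine ⟨trace_inv_mul_nonneg hA K, fun h0 => ?_⟩
  have hK0 := eq_zero_of_trace_inv_mul_eq_zero hA h0
  rw [hK, hs1, sub_eq_zero] at hK0
  rw [mul_smul, ← hK0, smul_smul]
  norm_num

theorem shapeDefect_nonneg (hJ : IsOpen J) (hI : IsInnerFamily I J G) (hr : r ∈ J) (x : N) :
    0 ≤ shapeDefect I G h (r, x) :=
  mul_nonneg (sq_nonneg _) (trace_shape_sub_sq hJ hI hr x _).1

variable [IsManifold I ∞ N]

theorem SmoothMetricOn.isSmoothFamily (hG : SmoothMetricOn I (radialMetric I G) (J ×ˢ univ)) :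
    IsSmoothFamily I J G := by
  intro x₀ i j
  -- The base point 0 is immaterial: the chart of the factor ℝ is the identity everywhere.
  have h := contDiffOn_coordMatrix (b := radialBasis d) hG (0, x₀) (Sum.inr i) (Sum.inr j)
  refine (h.mono fun z hz => ⟨?_, hz.1, mem_univ _⟩).congr fun z hz => ?_
  · rw [extChartAt_prod]
    exact ⟨by rw [extChartAt_model_space_eq_id]; exact mem_univ _, hz.2⟩
  · rw [coordMatrix_radial (p := (0, x₀)) hz.2, Matrix.fromBlocks_apply₂₂]

theorem isSmoothFamily_warped (hh : ContDiffOn ℝ ∞ h J) (γ : Metric I N) :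
    IsSmoothFamily I J fun r x => h r ^ 2 • γ.inner x := by
  intro x₀ i j
  have h1 := contDiffOn_coordMatrix (b := stdBasis d) γ.contMDiff.contMDiffOn (s := univ) x₀ i j
  simp only [preimage_univ, inter_univ] at h1
  have h2 : ContDiffOn ℝ ∞ (fun z : ℝ × EuclideanSpace ℝ (Fin d) => h z.1 ^ 2 *
      coordMatrix I (stdBasis d) γ.inner x₀ z.2 i j) (J ×ˢ (extChartAt I x₀).target) :=
    ((hh.comp contDiffOn_fst fun z hz => hz.1).pow 2).mul (h1.comp contDiffOn_snd fun z hz => hz.2)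
  exact h2

theorem isInnerFamily_metric (G : ℝ → Metric I N) : IsInnerFamily I J fun r => (G r).inner :=
  fun r _ x => ⟨(G r).symm x, (G r).pos x⟩

theorem isInnerFamily_warped (hpos : ∀ r ∈ J, 0 < h r) (γ : Metric I N) :
    IsInnerFamily I J fun r x => h r ^ 2 • γ.inner x := fun r hr x =>
  ⟨fun v w => congrArg (h r ^ 2 * ·) (γ.symm x v w),
    fun v hv => mul_pos (pow_pos (hpos r hr) 2) (γ.pos x v hv)⟩

/-- The Weingarten map of a warped product is `h' / h` times the identity. -/
theorem shape_of_conformal (hJ : IsOpen J) (hh : DifferentiableOn ℝ h J)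
    (hpos : ∀ r ∈ J, 0 < h r) (γ : Metric I N) (hr : r ∈ J) {x : N}
    (hG : ∀ t ∈ J, G t x = h t ^ 2 • γ.inner x) :
    shape I G r x = (deriv h r / h r) • 1 := by
  have hform : ∀ t ∈ J, formMatrix (G t x) = h t ^ 2 • formMatrix (γ.inner x) := fun t ht => by
    rw [hG t ht]; rfl
  have hne := (hpos r hr).ne'
  have hd : formDeriv I G r x = (2 * h r * deriv h r) • formMatrix (γ.inner x) := by
    ext i j
    have h1 : HasDerivAt h (deriv h r) r := (hh.differentiableAt (hJ.mem_nhds hr)).hasDerivAt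
    have h2 : HasDerivAt (fun t => formMatrix (G t x) i j)
        (((2 : ℕ) * h r ^ (2 - 1) * deriv h r) * formMatrix (γ.inner x) i j) r := by
      refine ((h1.fun_pow 2).mul_const _).congr_of_eventuallyEq ?_
      filter_upwards [hJ.mem_nhds hr] with t ht
      rw [hform t ht]; rfl
    refine h2.deriv.trans ?_
    simp
  have hA := posDef_formMatrix (γ.symm x) (γ.pos x)
  have hs : (formMatrix (γ.inner x)).transpose = formMatrix (γ.inner x) :=
    isSymm_formMatrix (γ.symm x)
  have hu : IsUnit (formMatrix (γ.inner x)).det := isUnit_iff_ne_zero.2 hA.det_pos.ne'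
  rw [shape, hd, hform r hr, inv_smul_of_ne_zero (pow_ne_zero 2 hne) hu, Matrix.transpose_smul, hs,
    Matrix.smul_mul, Matrix.mul_smul, Matrix.nonsing_inv_mul _ hu, smul_smul, smul_smul]
  congr 1
  field_simp

/-- The square is expanded so that only tr S and tr S² occur. These are invariant under change of
basis and known to be continuous, unlike the entries of `shape`. -/
theorem continuousOn_shapeDefect (hJ : IsOpen J) (hG : IsSmoothFamily I J G)
    (hI : IsInnerFamily I J G) (hh : ContDiffOn ℝ ∞ h J) (hpos : ∀ r ∈ J, 0 < h r) :
    ContinuousOn (shapeDefect I G h) (J ×ˢ univ) := by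
  have hfst : ContinuousOn (fun p : ℝ × N => h p.1) (J ×ˢ univ) :=
    hh.continuousOn.comp continuousOn_fst fun p hp => hp.1
  have hder : ContinuousOn (fun p : ℝ × N => deriv h p.1) (J ×ˢ univ) :=
    (hh.continuousOn_deriv_of_isOpen hJ (by simp)).comp continuousOn_fst fun p hp => hp.1
  have hk := hder.div hfst fun p hp => (hpos p.1 hp.1).ne'
  have hH : ContinuousOn (fun p : ℝ × N => (shape I G p.1 p.2).trace) (J ×ˢ univ) :=
    (continuousOn_meanCurvature hJ hG hI).congr fun p hp =>
      (meanCurvature_eq_trace_shape hJ hG hI hp.1 p.2).symm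
  refine ((hfst.pow 2).mul (((continuousOn_trace_shape_sq hJ hG hI).sub
    ((continuousOn_const (c := (2 : ℝ)).mul hk).mul hH)).add
      (continuousOn_const (c := (d : ℝ)).mul (hk.pow 2)))).congr fun p _ => ?_
  rw [shapeDefect, trace_sub_smul_one_sq]
  rfl

/-- The derivative `∂ᵣ m` of the radial mass. -/
def radialMassDeriv (I : ModelWithCorners ℝ (EuclideanSpace ℝ (Fin d)) H)
    (G : ℝ → ∀ x : N, TangentSpace I x →L[ℝ] TangentSpace I x →L[ℝ] ℝ) (h : ℝ → ℝ)
    (γ : ∀ x : N, TangentSpace I x →L[ℝ] TangentSpace I x →L[ℝ] ℝ) (p : ℝ × N) : ℝ :=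
  2 * h p.1 * deriv h p.1 *
      (meanCurvature I (warpedMetric I h γ) p - meanCurvature I (radialMetric I G) p) +
    h p.1 ^ 2 * (deriv (fun t => meanCurvature I (warpedMetric I h γ) (t, p.2)) p.1 -
      deriv (fun t => meanCurvature I (radialMetric I G) (t, p.2)) p.1)

theorem hasDerivAt_radialMass (hJ : IsOpen J) (hG : IsSmoothFamily I J G)
    (hI : IsInnerFamily I J G) (hh : ContDiffOn ℝ ∞ h J) (hpos : ∀ r ∈ J, 0 < h r)
    (γ : Metric I N) (hr : r ∈ J) (x : N) :
    HasDerivAt (fun t => radialMass I (radialMetric I G) h γ.inner (t, x))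
      (radialMassDeriv I G h γ.inner (r, x)) r := by
  have h1 : HasDerivAt h (deriv h r) r :=
    ((hh.differentiableOn (by simp)).differentiableAt (hJ.mem_nhds hr)).hasDerivAt
  have h2 := (hasDerivAt_meanCurvature hJ hG hI hr
    (mem_extChartAt_source x)).differentiableAt.hasDerivAt
  have h3 := (hasDerivAt_meanCurvature hJ (isSmoothFamily_warped hh γ)
    (isInnerFamily_warped hpos γ) hr (mem_extChartAt_source x)).differentiableAt.hasDerivAt
  have h4 := (h1.fun_pow 2).mul (h3.sub h2)
  simp only [Nat.cast_ofNat, Nat.add_one_sub_one, pow_one] at h4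
  exact h4

theorem continuousOn_radialMass (hJ : IsOpen J) (hG : IsSmoothFamily I J G)
    (hI : IsInnerFamily I J G) (hh : ContDiffOn ℝ ∞ h J) (hpos : ∀ r ∈ J, 0 < h r)
    (γ : Metric I N) :
    ContinuousOn (radialMass I (radialMetric I G) h γ.inner) (J ×ˢ univ) := by
  have hfst : ContinuousOn (fun p : ℝ × N => h p.1) (J ×ˢ univ) :=
    hh.continuousOn.comp continuousOn_fst fun p hp => hp.1
  exact (hfst.pow 2).mul ((continuousOn_meanCurvature hJ (isSmoothFamily_warped hh γ)
    (isInnerFamily_warped hpos γ)).sub (continuousOn_meanCurvature hJ hG hI))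

theorem continuousOn_radialMassDeriv (hJ : IsOpen J) (hG : IsSmoothFamily I J G)
    (hI : IsInnerFamily I J G) (hh : ContDiffOn ℝ ∞ h J) (hpos : ∀ r ∈ J, 0 < h r)
    (γ : Metric I N) :
    ContinuousOn (radialMassDeriv I G h γ.inner) (J ×ˢ univ) := by
  have hfst : ContinuousOn (fun p : ℝ × N => h p.1) (J ×ˢ univ) :=
    hh.continuousOn.comp continuousOn_fst fun p hp => hp.1
  have hder : ContinuousOn (fun p : ℝ × N => deriv h p.1) (J ×ˢ univ) :=
    (hh.continuousOn_deriv_of_isOpen hJ (by simp)).comp continuousOn_fst fun p hp => hp.1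
  have hw := isSmoothFamily_warped hh γ
  have hwI := isInnerFamily_warped hpos γ
  exact (((continuousOn_const (c := (2 : ℝ)).mul hfst).mul hder).mul
    ((continuousOn_meanCurvature hJ hw hwI).sub (continuousOn_meanCurvature hJ hG hI))).add
    ((hfst.pow 2).mul ((continuousOn_deriv_meanCurvature hJ hw hwI).sub
      (continuousOn_deriv_meanCurvature hJ hG hI)))

/-- Replace ∂ᵣH and ∂ᵣH₀ by the Riccati equation and H₀ by dk, where k = h'/h. Besides the Ricci
difference there remains h²(tr S² - dk² + 2k(dk - H)), which is h² tr (S - k)². -/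
theorem radialMassDeriv_eq (hJ : IsOpen J) (hG : IsSmoothFamily I J G)
    (hI : IsInnerFamily I J G) (hh : ContDiffOn ℝ ∞ h J) (hpos : ∀ r ∈ J, 0 < h r)
    (γ : Metric I N) (hr : r ∈ J) (x : N) :
    radialMassDeriv I G h γ.inner (r, x) =
      ricciDefect I (radialMetric I G) h γ.inner (r, x) + shapeDefect I G h (r, x) := by
  have hw := isSmoothFamily_warped hh γ
  have hwI := isInnerFamily_warped hpos γ
  have hS := shape_of_conformal (x := x) hJ (hh.differentiableOn (by simp)) hpos γ hr
    (G := fun r x => h r ^ 2 • γ.inner x) fun _ _ => rfl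
  have hR0 := ricciRR_eq hJ hw hwI hr x
  have hH0 := meanCurvature_eq_trace_shape hJ hw hwI hr x
  rw [hS, Matrix.smul_mul, Matrix.one_mul, Matrix.trace_smul, Matrix.trace_smul, Matrix.trace_one,
    Fintype.card_fin, smul_eq_mul, smul_eq_mul] at hR0
  rw [hS, Matrix.trace_smul, Matrix.trace_one, Fintype.card_fin, smul_eq_mul] at hH0
  have hR := ricciRR_eq hJ hG hI hr x
  have hH := meanCurvature_eq_trace_shape hJ hG hI hr x
  have hne := (hpos r hr).ne'
  simp only [radialMassDeriv, ricciDefect, shapeDefect, trace_sub_smul_one_sq]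
  change 2 * h r * deriv h r * (meanCurvature I (radialMetric I fun r x => h r ^ 2 • γ.inner x)
    (r, x) - _) + h r ^ 2 * (deriv (fun t => meanCurvature I
      (radialMetric I fun r x => h r ^ 2 • γ.inner x) (t, x)) r - _) =
      h r ^ 2 * (_ - ricciRR I (radialMetric I fun r x => h r ^ 2 • γ.inner x) (r, x)) + _
  rw [hR0, hH0, hR, hH]
  field_simp
  ring

end MassIdentity

/-! ### The equality case -/

section Rigidity

variable {d : ℕ} {H : Type*} [TopologicalSpace H]
  {I : ModelWithCorners ℝ (EuclideanSpace ℝ (Fin d)) H}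
  {N : Type*} [TopologicalSpace N] [ChartedSpace H N]
  {J : Set ℝ} {h : ℝ → ℝ}

theorem radialMetric_eq_warpedMetric_iff
    {G : ℝ → ∀ x : N, TangentSpace I x →L[ℝ] TangentSpace I x →L[ℝ] ℝ}
    {γ : ∀ x : N, TangentSpace I x →L[ℝ] TangentSpace I x →L[ℝ] ℝ} (p : ℝ × N) :
    radialMetric I G p = warpedMetric I h γ p ↔ G p.1 p.2 = h p.1 ^ 2 • γ p.2 := by
  constructor
  · intro heq
    refine ext_stdBasis fun i j => ?_
    have := congrArg (fun f : (ℝ × EuclideanSpace ℝ (Fin d)) →L[ℝ]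
      (ℝ × EuclideanSpace ℝ (Fin d)) →L[ℝ] ℝ => f (0, stdBasis d i) (0, stdBasis d j)) heq
    have h1 := (radialMetric_apply I G p 0 0 (stdBasis d i) (stdBasis d j)).symm.trans this
    have h2 := h1.trans (radialMetric_apply I (fun r x => h r ^ 2 • γ x) p 0 0 (stdBasis d i)
      (stdBasis d j))
    simp only [zero_mul, zero_add] at h2
    exact h2
  · intro heq
    rw [warpedMetric, radialMetric, radialMetric, heq]

variable [IsManifold I ∞ N]

/-- The metric `c γ`, for `c > 0`. -/
def scaleMetric (c : ℝ) (hc : 0 < c) (γ : Metric I N) : Metric I N where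
  inner x := c • γ.inner x
  symm x v w := congrArg (c * ·) (γ.symm x v w)
  pos x v hv := mul_pos hc (γ.pos x v hv)
  -- The unit ball of cγ is covered by the image of the unit ball of γ under multiplication by 1/√c.
  isVonNBounded x := by
    have hs := Real.sqrt_pos.2 hc
    have h := (γ.isVonNBounded x).image
      ((Real.sqrt c)⁻¹ • ContinuousLinearMap.id ℝ (TangentSpace I x))
    refine Bornology.IsVonNBounded.subset ?_ h
    intro v hv
    refine ⟨Real.sqrt c • v, ?_, ?_⟩
    · have hv' : c * γ.inner x v v < 1 := hv
      simp only [mem_ofPred_eq, map_smul, smul_apply, smul_eq_mul]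
      rwa [← mul_assoc, Real.mul_self_sqrt hc.le]
    · simp [smul_smul, mul_inv_cancel₀ hs.ne']
  contMDiff := contMDiff_const.smul_section γ.contMDiff

/-- Each component f of G satisfies f' = 2(h'/h) f, so f/h² is constant on the connected set J. Its
value at the reference radius s provides Γ = h(s)⁻² G(s), which is thereby already a smooth metric.
-/
theorem conformal_of_shapeDefect_eq_zero (hJ : IsOpen J) (hJ' : IsPreconnected J)
    {G : ℝ → Metric I N} (hG : IsSmoothFamily I J fun r => (G r).inner)
    (hh : DifferentiableOn ℝ h J) (hpos : ∀ r ∈ J, 0 < h r)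
    (h0 : ∀ p ∈ J ×ˢ univ, shapeDefect I (fun r => (G r).inner) h p = 0) {s : ℝ} (hs : s ∈ J) :
    ∃ Γ : Metric I N, ∀ r ∈ J, ∀ x, (G r).inner x = h r ^ 2 • Γ.inner x := by
  have hI : IsInnerFamily I J fun r => (G r).inner := isInnerFamily_metric G
  refine ⟨scaleMetric (h s ^ 2)⁻¹ (inv_pos.2 (pow_pos (hpos s hs) 2)) (G s), fun r hr x => ?_⟩
  refine ext_stdBasis fun i j => ?_
  set f : ℝ → ℝ := fun t => formMatrix ((G t).inner x) i j with hf
  have hderiv : ∀ t ∈ J, HasDerivAt f (2 * (deriv h t / h t) * f t) t := fun t ht => by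
    have h1 := (exists_chartShape_eq_conj hJ hG ht (mem_extChartAt_source x)).1 i j
    have h2 := h0 (t, x) ⟨ht, mem_univ x⟩
    have h3 := (mul_eq_zero.1 h2).resolve_left (pow_pos (hpos t ht) 2).ne'
    rw [(trace_shape_sub_sq hJ hI ht x _).2 h3] at h1
    exact h1
  have hq : ∀ t ∈ J, HasDerivAt (fun t => f t / h t ^ 2) 0 t := fun t ht => by
    have hne := (hpos t ht).ne'
    have h1 : HasDerivAt h (deriv h t) t := (hh.differentiableAt (hJ.mem_nhds ht)).hasDerivAt
    refine ((hderiv t ht).div (h1.fun_pow 2) (pow_ne_zero 2 hne)).congr_deriv ?_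
    field_simp
    ring
  have hconst : f r / h r ^ 2 = f s / h s ^ 2 :=
    hJ.is_const_of_deriv_eq_zero hJ' (f := fun t => f t / h t ^ 2)
      (fun t ht => (hq t ht).differentiableAt.differentiableWithinAt)
      (fun t ht => (hq t ht).deriv) hr hs
  have hrne := (pow_pos (hpos r hr) 2).ne'
  have : f r = h r ^ 2 * ((h s ^ 2)⁻¹ * f s) := by
    rw [div_eq_iff hrne] at hconst
    rw [hconst]; ring
  exact this

theorem shapeDefect_eq_zero_of_conformal (hJ : IsOpen J)
    {G : ℝ → ∀ x : N, TangentSpace I x →L[ℝ] TangentSpace I x →L[ℝ] ℝ}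
    (hh : DifferentiableOn ℝ h J) (hpos : ∀ r ∈ J, 0 < h r) (Γ : Metric I N)
    (hG : ∀ r ∈ J, ∀ x, G r x = h r ^ 2 • Γ.inner x) :
    ∀ p ∈ J ×ˢ univ, shapeDefect I G h p = 0 := by
  rintro ⟨r, x⟩ hp
  rw [shapeDefect, shape_of_conformal hJ hh hpos Γ hp.1 fun t ht => hG t ht x]
  simp

/-- The two factors of the inverse of cγ cancel the two factors c of the tensor, so this relative
norm is invariant under scaling. -/
theorem tensorNorm_smul_sub (c : ℝ) (hc : c ≠ 0)
    {γ T : EuclideanSpace ℝ (Fin d) →L[ℝ] EuclideanSpace ℝ (Fin d) →L[ℝ] ℝ}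
    (hs : ∀ v w, γ v w = γ w v) (hpos : ∀ v, v ≠ 0 → 0 < γ v v) :
    tensorNorm (c • γ) (c • T - c • γ) = Real.sqrt ((formMatrix γ)⁻¹ * formMatrix (T - γ) *
      ((formMatrix γ)⁻¹ * (formMatrix (T - γ)).transpose)).trace := by
  have hu : IsUnit (formMatrix γ).det :=
    isUnit_iff_ne_zero.2 (posDef_formMatrix hs hpos).det_pos.ne'
  have hsymm : (c • formMatrix γ)⁻¹.IsSymm := by
    rw [Matrix.IsSymm, Matrix.transpose_nonsing_inv, Matrix.transpose_smul,
      (isSymm_formMatrix hs).eq]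
  have hcancel : ∀ K, (c • formMatrix γ)⁻¹ * (c • K) = (formMatrix γ)⁻¹ * K := fun K => by
    rw [inv_smul_of_ne_zero hc hu, Matrix.smul_mul, Matrix.mul_smul, smul_smul, inv_mul_cancel₀ hc,
      one_smul]
  have hK : c • formMatrix (T - γ) =
      Matrix.of fun i j => (c • T - c • γ) (stdBasis d i) (stdBasis d j) := by
    ext i j
    exact mul_sub c _ _
  rw [tensorNorm_eq (c • γ) (c • T - c • γ) (A := c • formMatrix γ) rfl hK hsymm, Matrix.transpose_smul, hcancel, hcancel]

/-- By scale invariance the norm at (r, x) is that of Γ - Ĝ with respect to Ĝ at x, a number √τ free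
of r. The limit condition makes it smaller than every ε, at some r in (a, b). -/
theorem eq_of_asymptoticAt {a b r₀ : EReal} (hab : a < b) (hr₀ : r₀ ∈ Icc a b)
    {G : ℝ → ∀ x : N, TangentSpace I x →L[ℝ] TangentSpace I x →L[ℝ] ℝ} {Γ γ : Metric I N}
    (hpos : ∀ r ∈ realIoo a b, 0 < h r)
    (hG : ∀ r ∈ realIoo a b, ∀ x, G r x = h r ^ 2 • Γ.inner x)
    (has : AsymptoticAt I a b r₀ G h γ.inner) (x : N) : Γ.inner x = γ.inner x := by
  set τ : ℝ := ((formMatrix (γ.inner x))⁻¹ * formMatrix (Γ.inner x - γ.inner x) *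
      ((formMatrix (γ.inner x))⁻¹ * (formMatrix (Γ.inner x - γ.inner x)).transpose)).trace with hτ
  have hA := posDef_formMatrix (γ.symm x) (γ.pos x)
  have hle : ∀ ε > 0, Real.sqrt τ < ε := fun ε hε => by
    have := nhdsIoo_neBot hab hr₀
    obtain ⟨r, hr, hrJ⟩ := ((has ε hε).and (mem_nhdsIoo a b r₀)).exists
    have h1 := hr x
    rw [hG r hrJ] at h1
    refine lt_of_eq_of_lt ?_ h1
    exact (tensorNorm_smul_sub _ (pow_pos (hpos r hrJ) 2).ne' (γ.symm x) (γ.pos x)).symm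
  have hτ0 : τ = 0 := by
    refine le_antisymm (not_lt.1 fun hlt => ?_) (trace_inv_mul_nonneg hA _)
    exact lt_irrefl _ (hle _ (Real.sqrt_pos.2 hlt))
  have hK := eq_zero_of_trace_inv_mul_eq_zero hA hτ0
  refine ext_stdBasis fun i j => ?_
  have := congrFun (congrFun hK i) j
  exact sub_eq_zero.1 this

end Rigidity

end RadialMass

end

theorem theorem1p1 {n : ℕ} (hn : 2 ≤ n)
    {H : Type*} [TopologicalSpace H]
    (I : ModelWithCorners ℝ (EuclideanSpace ℝ (Fin (n - 1))) H)
    {N : Type*} [TopologicalSpace N] [ChartedSpace H N] [IsManifold I ∞ N]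
    [CompactSpace N] [T2Space N] [MeasurableSpace N] [BorelSpace N]
    (a b : EReal) (hab : a < b)
    -- the metric `g = dr² + G(r)` on `M = (a, b) × N`
    (G : ℝ → RadialMass.Metric I N)
    (hG : RadialMass.SmoothMetricOn I (RadialMass.radialMetric I fun r => (G r).inner)
      (RadialMass.realIoo a b ×ˢ univ))
    -- the background metric `g₀ = dr² + h(r)² Ĝ`
    (h : ℝ → ℝ) (hh : ContDiffOn ℝ ∞ h (RadialMass.realIoo a b))
    (hpos : ∀ r ∈ RadialMass.realIoo a b, 0 < h r)
    (Ghat : RadialMass.Metric I N)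
    -- the limits of the mass at the two ends
    (Ma Mb : ℝ)
    (hMa : Tendsto (RadialMass.totalMass I (RadialMass.radialMetric I fun r => (G r).inner)
      h Ghat.inner) (RadialMass.nhdsIoo a b a) (𝓝 Ma))
    (hMb : Tendsto (RadialMass.totalMass I (RadialMass.radialMetric I fun r => (G r).inner)
      h Ghat.inner) (RadialMass.nhdsIoo a b b) (𝓝 Mb))
    (hint : IntegrableOn
      (RadialMass.ricciDefect I (RadialMass.radialMetric I fun r => (G r).inner) h Ghat.inner)
      (RadialMass.realIoo a b ×ˢ univ)
      (volume.prod (RadialMass.riemannianMeasure I Ghat.inner))) :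
    (Mb - Ma ≥ ∫ p in RadialMass.realIoo a b ×ˢ univ,
        RadialMass.ricciDefect I (RadialMass.radialMetric I fun r => (G r).inner) h Ghat.inner p
          ∂(volume.prod (RadialMass.riemannianMeasure I Ghat.inner))) ∧
    (Mb - Ma = ∫ p in RadialMass.realIoo a b ×ˢ univ,
        RadialMass.ricciDefect I (RadialMass.radialMetric I fun r => (G r).inner) h Ghat.inner p
          ∂(volume.prod (RadialMass.riemannianMeasure I Ghat.inner)) ↔
      ∃ Gtilde : RadialMass.Metric I N, ∀ r ∈ RadialMass.realIoo a b, ∀ x : N,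
        (G r).inner x = h r ^ 2 • Gtilde.inner x) ∧
    (∀ r₀ ∈ Icc a b, RadialMass.AsymptoticAt I a b r₀ (fun r => (G r).inner) h Ghat.inner →
      (Mb - Ma = ∫ p in RadialMass.realIoo a b ×ˢ univ,
        RadialMass.ricciDefect I (RadialMass.radialMetric I fun r => (G r).inner) h Ghat.inner p
          ∂(volume.prod (RadialMass.riemannianMeasure I Ghat.inner)) ↔
        ∀ p ∈ RadialMass.realIoo a b ×ˢ (univ : Set N),
          RadialMass.radialMetric I (fun r => (G r).inner) p
            = RadialMass.warpedMetric I h Ghat.inner p)) := by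
  have hJ := RadialMass.isOpen_realIoo a b
  have hJ' := (RadialMass.ordConnected_realIoo a b).isPreconnected
  have hS := hG.isSmoothFamily
  have hI : RadialMass.IsInnerFamily I (RadialMass.realIoo a b) fun r => (G r).inner :=
    RadialMass.isInnerFamily_metric G
  have hh' := hh.differentiableOn (by simp)
  -- A compact N is covered by countably many charts and so inherits second countability from the
  -- model space.
  have : SecondCountableTopology H := I.secondCountableTopology
  have : SecondCountableTopology N := ChartedSpace.secondCountable_of_sigmaCompact H N
  have := RadialMass.isFiniteMeasure_riemannianMeasure Ghat
  have := RadialMass.isOpenPosMeasure_riemannianMeasure Ghat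
  obtain ⟨hge, heq⟩ := RadialMass.monotonicity hab
    (RadialMass.continuousOn_radialMass hJ hS hI hh hpos Ghat)
    (RadialMass.continuousOn_radialMassDeriv hJ hS hI hh hpos Ghat)
    (RadialMass.continuousOn_shapeDefect hJ hS hI hh hpos)
    (fun r hr x => RadialMass.hasDerivAt_radialMass hJ hS hI hh hpos Ghat hr x)
    (fun p hp => RadialMass.radialMassDeriv_eq hJ hS hI hh hpos Ghat hp.1 p.2)
    (fun p hp => RadialMass.shapeDefect_nonneg hJ hI hp.1 p.2) hMa hMb hint
  -- Any real radius in (a, b) serves as the reference at which the fixed metric on N is read off.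
  obtain ⟨s, hs⟩ := EReal.lt_iff_exists_real_btwn.1 hab
  refine ⟨hge, heq.trans ⟨fun h0 => ?_, fun ⟨Γ, hΓ⟩ => ?_⟩, fun r₀ hr₀ has =>
    heq.trans ⟨fun h0 p hp => ?_, fun hg => ?_⟩⟩
  · exact RadialMass.conformal_of_shapeDefect_eq_zero hJ hJ' hS hh' hpos h0 hs
  · exact RadialMass.shapeDefect_eq_zero_of_conformal hJ hh' hpos Γ hΓ
  · obtain ⟨Γ, hΓ⟩ := RadialMass.conformal_of_shapeDefect_eq_zero hJ hJ' hS hh' hpos h0 hs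
    refine (RadialMass.radialMetric_eq_warpedMetric_iff p).2 ?_
    rw [hΓ p.1 hp.1 p.2, RadialMass.eq_of_asymptoticAt hab hr₀ hpos hΓ has p.2]
  · refine RadialMass.shapeDefect_eq_zero_of_conformal hJ hh' hpos Ghat fun r hr x => ?_
    exact (RadialMass.radialMetric_eq_warpedMetric_iff (r, x)).1 (hg (r, x) ⟨hr, mem_univ x⟩)
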